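/- Let $M$ be a smooth finite-dimensional real manifold without boundary, and for $r\ge 0$ let $\Phi^r(M)$ be the space of smooth $r$-vector fields on $M$ (smooth sections of $\bigwedge^r TM$; $\Phi^0(M)=C^\infty(M)$), an $r$-vector field $X$ being regarded as the fibrewise $r$-linear skew-symmetric function $\widetilde X$ which it defines on covectors. Let $\varepsilon_M\colon T^*TM\to TT^*M$ be the canonical isomorphism, $(x,\dot x,\pi,\dot\pi)\mapsto(x,p,\dot x,\dot p)=(x,\dot\pi,\dot x,\pi)$ in adapted coordinates. The tangent lift $d_TX$ of $X\in\Phi^r(M)$ is the $r$-vector field on $TM$ given by $$ d_TX(a_1,\dots,a_r)=d\widetilde X\bigl(\varepsilon_M(a_1),\dots,\varepsilon_M(a_r)\bigr)\qquad (a_1,\dots,a_r\in T^*_vTM,\ v\in TM), $$ that is, for $X=X^{i_1\dots i_r}\,\partial_{x^{i_1}}\wedge\dots\wedge\partial_{x^{i_r}}$ in local coordinates, $$ d_TX=\frac{\partial X^{i_1\dots i_r}}{\partial x^k}\,\dot x^k\,\partial_{\dot x^{i_1}}\wedge\dots\wedge\partial_{\dot x^{i_r}}+\sum_{m=1}^r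 X^{i_1\dots i_r}\,\partial_{\dot x^{i_1}}\wedge\dots\wedge\partial_{x^{i_m}}\wedge\dots\wedge\partial_{\dot x^{i_r}} ; $$ for $r=0$, $d_Tf(v)=\langle v,df\rangle$. Let $[\cdot,\cdot]\colon\Phi^p\times\Phi^q\to\Phi^{p+q-1}$ be the Schouten bracket, i.e. the graded Lie bracket extending the Lie bracket of vector fields, with $[X,f]=X(f)$ for a vector field $X$ and a function $f$, with $[f,g]=0$ for functions, and with $[X,Y\wedge Z]=[X,Y]\wedge Z+(-1)^{q(p-1)}\,Y\wedge[X,Z]$ for $X\in\Phi^p$, $Y\in\Phi^q$. **Theorem 2.5.** For every $r\ge0$, $d_T$ maps $\Phi^r(M)$ into $\Phi^r(TM)$, and for all $p,q\ge0$, $X\in\Phi^p(M)$ and $Y\in\Phi^q(M)$, $[X,Y]$ is smooth and $$ [d_TX,d_TY]=d_T[X,Y]. $$ Consequently, if $\Lambda\in\Phi^2(M)$ is a Poisson bivector, i.e. $[\Lambda,\Lambda]=0$, then $d_T\Lambda$ is a Poisson bivector on $TM$ (the tangent Poisson structure). -/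

import Mathlib

open scoped Manifold ContDiff Topology

noncomputable section

/-! ## Pointwise exterior algebra

An `r`-vector on a finite-dimensional space `E` is represented by the alternating `r`-linear form
which it defines on the dual space `E →L[ℝ] ℝ`; a decomposable `r`-vector `e₁ ∧ ⋯ ∧ e_r`
corresponds to the form `(β₁, …, β_r) ↦ det (β_k (e_j))`. -/

section Algebra

/-- Alternating `r`-linear forms on a normed space. -/
abbrev AltForm (V : Type*) [NormedAddCommGroup V] [NormedSpace ℝ V] (r : ℕ) :=
  V [⋀^Fin r]→L[ℝ] ℝ

/-- The `r`-vectors on a finite-dimensional space `E`, as alternating forms on its dual. -/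
abbrev Multivector (E : Type*) [NormedAddCommGroup E] [NormedSpace ℝ E] (r : ℕ) :=
  AltForm (E →L[ℝ] ℝ) r

theorem update_castAdd_comp {W : Type*} {p q : ℕ} (v : Fin (p + q) → W) (i : Fin p) (z : W) :
    ((fun k : Fin p => Function.update v (Fin.castAdd q i) z (Fin.castAdd q k)) =
      Function.update (fun k => v (Fin.castAdd q k)) i z) ∧
    ((fun k : Fin q => Function.update v (Fin.castAdd q i) z (Fin.natAdd p k)) =
      fun k => v (Fin.natAdd p k)) := by
  constructor
  · ext k; simp [Function.update_apply]
  · ext k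
    rw [Function.update_of_ne]
    simp only [ne_eq, Fin.ext_iff, Fin.val_natAdd, Fin.val_castAdd]; omega

theorem update_natAdd_comp {W : Type*} {p q : ℕ} (v : Fin (p + q) → W) (i : Fin q) (z : W) :
    ((fun k : Fin q => Function.update v (Fin.natAdd p i) z (Fin.natAdd p k)) =
      Function.update (fun k => v (Fin.natAdd p k)) i z) ∧
    ((fun k : Fin p => Function.update v (Fin.natAdd p i) z (Fin.castAdd q k)) =
      fun k => v (Fin.castAdd q k)) := by
  constructor
  · ext k; simp [Function.update_apply]
  · ext k
    rw [Function.update_of_ne]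
    simp only [ne_eq, Fin.ext_iff, Fin.val_natAdd, Fin.val_castAdd]; omega

variable {V F G : Type*} [NormedAddCommGroup V] [NormedSpace ℝ V]
  [NormedAddCommGroup F] [NormedSpace ℝ F] [NormedAddCommGroup G] [NormedSpace ℝ G]

/-- The multilinear map `(v₁, …, v_{p+q}) ↦ B (a (v₁, …, v_p)) (b (v_{p+1}, …, v_{p+q}))`. -/
def tensorPairing {p q n : ℕ} (h : p + q = n) (B : F →L[ℝ] G →L[ℝ] ℝ)
    (a : V [⋀^Fin p]→L[ℝ] F) (b : V [⋀^Fin q]→L[ℝ] G) :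
    ContinuousMultilinearMap ℝ (fun _ : Fin n => V) ℝ where
  toFun v := B (a fun i => v (Fin.cast h (Fin.castAdd q i)))
    (b fun j => v (Fin.cast h (Fin.natAdd p j)))
  map_update_add' := by
    intro d v i x y
    subst h
    obtain rfl : d = instDecidableEqFin (p + q) := Subsingleton.elim _ _
    induction i using Fin.addCases with
    | left i => simp [update_castAdd_comp]
    | right i => simp [update_natAdd_comp]
  map_update_smul' := by
    intro d v i c x
    subst h
    obtain rfl : d = instDecidableEqFin (p + q) := Subsingleton.elim _ _
    induction i using Fin.addCases with
    | left i => simp [update_castAdd_comp]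
    | right i => simp [update_natAdd_comp]
  cont := by
    have ha : Continuous fun v : Fin n → V => a fun i => v (Fin.cast h (Fin.castAdd q i)) :=
      a.cont.comp (by fun_prop)
    have hb : Continuous fun v : Fin n → V => b fun j => v (Fin.cast h (Fin.natAdd p j)) :=
      b.cont.comp (by fun_prop)
    exact (B.continuous.comp ha).clm_apply hb

/-- The wedge product of alternating maps whose values are paired by `B`:
`(v₁, …, v_{p+q}) ↦ ∑ sgn σ · B (a (v_{σ 1}, …, v_{σ p})) (b (v_{σ (p+1)}, …, v_{σ (p+q)}))`,
the sum being over the `(p, q)`-shuffles `σ`; equivalently, the sum over all permutations divided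
by `p! q!`. -/
def wedgePairing {p q n : ℕ} (h : p + q = n) (B : F →L[ℝ] G →L[ℝ] ℝ)
    (a : V [⋀^Fin p]→L[ℝ] F) (b : V [⋀^Fin q]→L[ℝ] G) : AltForm V n :=
  ((p.factorial * q.factorial : ℝ)⁻¹) •
    ContinuousMultilinearMap.alternatization (tensorPairing h B a b)

/-- `(v₁, …, v_p) ↦ (α ↦ P (α, v₁, …, v_p))`: the first argument is left free. -/
def freeFirst {p : ℕ} (P : AltForm V (p + 1)) : V [⋀^Fin p]→L[ℝ] (V →L[ℝ] ℝ) :=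
  P.curryLeft.flipAlternating

/-- `(v₁, …, v_p) ↦ (α ↦ P (v₁, …, v_p, α))`: the last argument is left free. -/
def freeLast {p : ℕ} (P : AltForm V (p + 1)) : V [⋀^Fin p]→L[ℝ] (V →L[ℝ] ℝ) :=
  ((-1 : ℝ) ^ p) • freeFirst P

end Algebra

/-! ## The two operations on a vector space -/

section Local

variable {E : Type*} [NormedAddCommGroup E] [NormedSpace ℝ E]

/-- The covector-valued derivative `(β₁, …, β_p) ↦ d_x (P (β₁, …, β_p))` at `x`, with constant `β_k`,
of a map `P` with values in alternating forms. -/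
def diffAt {V : Type*} [NormedAddCommGroup V] [NormedSpace ℝ V] {p : ℕ} (P : E → AltForm V p)
    (x : E) : V [⋀^Fin p]→L[ℝ] (E →L[ℝ] ℝ) :=
  (fderiv ℝ P x).flipAlternating

/-- The part `∑ᵢ (∂P/∂θᵢ) ∧ (∂Q/∂xⁱ)` of the Schouten bracket, where `∂/∂θᵢ` is the contraction of
the last slot with `dxⁱ`. Evaluated on constant covectors it is
`∑ sgn σ · P (β_{σ 1}, …, β_{σ p}, d (Q (β_{σ (p+1)}, …, β_{σ (p+q)})))`, summed over shuffles. -/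
def schoutenLeftPart {p q n : ℕ} (h : p + q = n)
    (P : E → Multivector E (p + 1)) (Q : E → Multivector E q)
    (x : E) : Multivector E n :=
  wedgePairing h (ContinuousLinearMap.id ℝ ((E →L[ℝ] ℝ) →L[ℝ] ℝ)) (freeLast (P x)) (diffAt Q x)

/-- The part `∑ᵢ (∂P/∂xⁱ) ∧ (∂Q/∂θᵢ)` of the Schouten bracket, where `∂/∂θᵢ` is the contraction of
the first slot with `dxⁱ`. Evaluated on constant covectors it is
`∑ sgn σ · Q (d (P (β_{σ 1}, …, β_{σ p})), β_{σ (p+1)}, …, β_{σ (p+q)})`, summed over shuffles. -/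
def schoutenRightPart {p q n : ℕ} (h : p + q = n)
    (P : E → Multivector E p) (Q : E → Multivector E (q + 1))
    (x : E) : Multivector E n :=
  wedgePairing h (ContinuousLinearMap.id ℝ ((E →L[ℝ] ℝ) →L[ℝ] ℝ)).flip
    (diffAt P x) (freeFirst (Q x))

/-- The Schouten bracket of a `p`-vector field and a `q`-vector field on a vector space:
`[P, Q] = ∑ᵢ (∂P/∂θᵢ) ∧ (∂Q/∂xⁱ) - ∑ᵢ (∂P/∂xⁱ) ∧ (∂Q/∂θᵢ)`, with the right derivative of `P` and
the left derivative of `Q` in the odd variables `θᵢ = ∂/∂xⁱ`. It is the extension of the Lie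
bracket with `[X, f] = X f`, with
`[P, Q ∧ R] = [P, Q] ∧ R + (-1)^(q (p - 1)) Q ∧ [P, R]`, and with
`[X₁ ∧ ⋯ ∧ X_p, Y₁ ∧ ⋯ ∧ Y_q] = ∑ (-1)^(i+j) [X_i, Y_j] ∧ X₁ ∧ ⋯ X̂_i ⋯ ∧ X_p ∧ Y₁ ∧ ⋯ Ŷ_j ⋯ ∧ Y_q`.
The bracket of two functions, which has degree `-1`, is `0`. -/
def schoutenVS : {p q : ℕ} → (E → Multivector E p) →
    (E → Multivector E q) → E → Multivector E (p + q - 1)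
  | 0, 0, _, _, _ => 0
  | p + 1, 0, P, Q, x => schoutenLeftPart (by omega) P Q x
  | 0, q + 1, P, Q, x => -schoutenRightPart (by omega) P Q x
  | p + 1, q + 1, P, Q, x =>
      schoutenLeftPart (by omega) P Q x - schoutenRightPart (by omega) P Q x

/-- For a covector `a = (π, ϖ)` on `E × E = T E` (so `π = a ∘ inl` and `ϖ = a ∘ inr` are its
components along `dx` and `dẋ`), the curve of covectors `t ↦ ϖ + t π` on `E`. Placed over the base
curve `t ↦ x + t ẋ`, its velocity at `t = 0` is the vector `(x, p, ẋ, ṗ) = (x, ϖ, ẋ, π)`, which is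
the image of `a` under the canonical isomorphism `T*TE → TT*E`. -/
def covectorCurve (E : Type*) [NormedAddCommGroup E] [NormedSpace ℝ E] (t : ℝ) :
    ((E × E) →L[ℝ] ℝ) →L[ℝ] (E →L[ℝ] ℝ) :=
  ContinuousLinearMap.precomp ℝ (ContinuousLinearMap.inr ℝ E E) +
    t • ContinuousLinearMap.precomp ℝ (ContinuousLinearMap.inl ℝ E E)

/-- The tangent lift of an `r`-vector field `P` on a vector space `E`, an `r`-vector field on
`T E = E × E`. At `(x, ẋ)`, its value on covectors `a₁, …, a_r` is the derivative of the
fibrewise multilinear function `(x, p₁, …, p_r) ↦ P x (p₁, …, p_r)` in the direction of the images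
of the `a_k` under the canonical isomorphism `T*TE → TT*E`. -/
def tangentLiftVS {r : ℕ} (P : E → Multivector E r) (z : E × E) :
    Multivector (E × E) r :=
  deriv (F := Multivector (E × E) r)
    (fun t : ℝ => (P (z.1 + t • z.2)).compContinuousLinearMap (covectorCurve E t)) 0

end Local

/-! ## Multivector fields on manifolds -/

section Manifold

variable {E : Type*} [NormedAddCommGroup E] [NormedSpace ℝ E]
  {H : Type*} [TopologicalSpace H] (I : ModelWithCorners ℝ E H)

/-- A (not necessarily smooth) section of `⋀ʳ TM`, the fibre of `⋀ʳ TM` at `x` being the space of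
alternating `r`-linear forms on the cotangent space at `x`. -/
abbrev MultivectorField (M : Type*) [TopologicalSpace M] [ChartedSpace H M] (r : ℕ) :=
  ∀ x : M, (TangentSpace I x →L[ℝ] ℝ) [⋀^Fin r]→L[ℝ] ℝ

variable {M : Type*} [TopologicalSpace M] [ChartedSpace H M]

namespace MultivectorField

variable {I}

/-- The expression of a multivector field in the preferred chart at `x₀`, i.e. its push-forward
by this chart. Only its values on the target of the chart are meaningful. -/
def inChart {r : ℕ} (X : MultivectorField I M r) (x₀ : M) (z : E) :
    Multivector E r :=
  (X ((extChartAt I x₀).symm z)).compContinuousLinearMap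
    (ContinuousLinearMap.precomp ℝ
      (mfderiv I 𝓘(ℝ, E) (extChartAt I x₀) ((extChartAt I x₀).symm z)))

variable (I) in
/-- The `r`-vector at `x₀` whose expression in the preferred chart at `x₀` is `A`. -/
def ofChart {r : ℕ} (x₀ : M) (A : Multivector E r) :
    (TangentSpace I x₀ →L[ℝ] ℝ) [⋀^Fin r]→L[ℝ] ℝ :=
  A.compContinuousLinearMap
    (ContinuousLinearMap.precomp ℝ
      ((mfderiv I 𝓘(ℝ, E) (extChartAt I x₀) x₀).inverse : E →L[ℝ] TangentSpace I x₀))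

/-- A multivector field is smooth if it is so in the preferred charts. -/
def IsSmooth {r : ℕ} (X : MultivectorField I M r) : Prop :=
  ∀ x₀ : M, ContDiffOn ℝ ∞ (X.inChart x₀) (extChartAt I x₀).target

/-- The Schouten bracket of multivector fields on a manifold, computed in charts. -/
def schouten {p q : ℕ} (X : MultivectorField I M p) (Y : MultivectorField I M q) :
    MultivectorField I M (p + q - 1) :=
  fun x => ofChart I x (schoutenVS (X.inChart x) (Y.inChart x) (extChartAt I x x))

/-- The tangent lift `d_T` of a multivector field on `M` to the tangent bundle `TM`, computed at
`v ∈ TM` in the chart `(x, ẋ)` of `TM` induced by the preferred chart `x` of `M` at the base point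
of `v`. -/
def tangentLift [IsManifold I 1 M] {r : ℕ} (X : MultivectorField I M r) :
    MultivectorField I.tangent (TangentBundle I M) r :=
  fun v => ofChart I.tangent v (tangentLiftVS (X.inChart v.proj) (extChartAt I.tangent v v))

/-- A Poisson bivector (Poisson structure): a smooth bivector field `Λ` with `[Λ, Λ] = 0`. -/
def IsPoisson (L : MultivectorField I M 2) : Prop :=
  L.IsSmooth ∧ L.schouten L = 0

end MultivectorField

end Manifold

end

/-! On a vector space, `d_T P` at `(x, ẋ)` is the derivative at `t = 0` of `P` evaluated along `t ↦
(x + tẋ, ϖ + tπ)`. By the chain rule, any curves with the same values and velocities at `0` give the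
same result (`hasDerivAt_apply_curve`). Each half of the Schouten bracket is a signed sum, with
constant coefficients, of terms in which a differential of one field evaluated on covectors fills a
slot of the other. Under `d_T` this slot moves along a curve of covectors. Symmetry of the second
derivative shows that its value and velocity at `0` are the two components of the corresponding
differential of the lifted field (`diffAt_tangentLiftVS_comp_inr`,
`hasDerivAt_diffAt_covectorCurve`). So each half commutes with `d_T` separately.

On a manifold both operations are defined pointwise through preferred charts, so independence of the
chart is needed. For the lift, the curve argument applies again, with the symmetry of `D²ψ` for a
transition map `ψ`. The halves of the bracket are not invariant separately: each acquires a Hessian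
term of `ψ`. The two terms are equal because the Hessian is symmetric (`sum_slotSum_left_eq_right`),
so they cancel in the difference. Finally, transitions of `TM` are tangent maps of transitions of
`M` (`chartTransition_tangentBundle`), which reduces the theorem to the vector space identity. -/

/-! ### Smoothness of maps into spaces of alternating forms. -/

section FiniteDimensionalCalculus

variable {X W : Type*} [NormedAddCommGroup X] [NormedSpace ℝ X]
  [NormedAddCommGroup W] [NormedSpace ℝ W] [FiniteDimensional ℝ W]

/-- Smoothness of a map into a finite-dimensional space can be tested on a separating family of
linear functionals. -/
theorem contDiffAt_of_separating {ι : Type*} (L : ι → (W →ₗ[ℝ] ℝ))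
    (hL : ∀ w, (∀ i, L i w = 0) → w = 0) {n : ℕ∞ω} {f : X → W} {x : X}
    (hf : ∀ i, ContDiffAt ℝ n (fun y => L i (f y)) x) : ContDiffAt ℝ n f x := by
  -- Functionals with trivial common kernel span the dual, by a dimension count; smoothness then
  -- passes to every coordinate of `f`.
  have hspan : Submodule.span ℝ (Set.range L) = ⊤ := by
    have h0 : (Submodule.span ℝ (Set.range L)).dualCoannihilator = ⊥ := by
      rw [Submodule.eq_bot_iff]
      intro w hw
      refine hL w fun i => ?_
      rw [Submodule.mem_dualCoannihilator] at hw
      exact hw _ (Submodule.subset_span ⟨i, rfl⟩)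
    have h1 := Subspace.finrank_add_finrank_dualCoannihilator_eq (Submodule.span ℝ (Set.range L))
    rw [h0, finrank_bot, add_zero, ← Subspace.dual_finrank_eq] at h1
    exact Submodule.eq_top_of_finrank_eq h1
  have key : ∀ l : W →ₗ[ℝ] ℝ, ContDiffAt ℝ n (fun y => l (f y)) x := by
    intro l
    have hl : l ∈ Submodule.span ℝ (Set.range L) := hspan ▸ Submodule.mem_top
    induction hl using Submodule.span_induction with
    | mem l hl => obtain ⟨i, rfl⟩ := hl; exact hf i
    | zero => simpa using contDiffAt_const
    | add a b _ _ ha hb => simpa using ha.add hb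
    | smul c a _ ha => simpa using contDiffAt_const.mul ha
  let b := Module.finBasis ℝ W
  have : f = fun y => ∑ i, b.coord i (f y) • b i := by
    ext y; exact (b.sum_repr (f y)).symm
  rw [this]
  exact ContDiffAt.sum fun i _ => (key _).smul contDiffAt_const

instance finiteDimensional_altForm {V : Type*} [NormedAddCommGroup V] [NormedSpace ℝ V]
    [FiniteDimensional ℝ V] (r : ℕ) : FiniteDimensional ℝ (AltForm V r) := by
  let f : AltForm V r →ₗ[ℝ] MultilinearMap ℝ (fun _ : Fin r => V) ℝ :=
    { toFun := fun a => a.toMultilinearMap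
      map_add' := fun _ _ => rfl
      map_smul' := fun _ _ => rfl }
  refine FiniteDimensional.of_injective f fun a b h => ?_
  ext v
  exact congrArg (fun m : MultilinearMap ℝ (fun _ : Fin r => V) ℝ => m v) h

theorem contDiffAt_altForm {V : Type*} [NormedAddCommGroup V] [NormedSpace ℝ V]
    [FiniteDimensional ℝ V] {r : ℕ} {n : ℕ∞ω} {f : X → AltForm V r} {x : X} :
    ContDiffAt ℝ n f x ↔ ∀ v, ContDiffAt ℝ n (fun y => f y v) x := by
  refine ⟨fun h v => ?_, fun h => ?_⟩
  · exact (ContinuousAlternatingMap.apply ℝ V ℝ v).contDiff.contDiffAt.comp x h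
  · refine contDiffAt_of_separating
      (fun v => (ContinuousAlternatingMap.apply ℝ V ℝ v).toLinearMap) ?_ h
    intro w hw
    ext v
    exact hw v

/-- Induction on the degree: currying is bounded linear, so arguments can be inserted one at a time.
-/
theorem ContDiffAt.altForm_apply {V : Type*} [NormedAddCommGroup V] [NormedSpace ℝ V]
    {r : ℕ} {n : ℕ∞ω} {f : X → AltForm V r} {x : X} {g : Fin r → X → V}
    (hf : ContDiffAt ℝ n f x) (hg : ∀ i, ContDiffAt ℝ n (g i) x) :
    ContDiffAt ℝ n (fun y => f y (fun i => g i y)) x := by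
  induction r with
  | zero =>
    have : (fun y => f y fun i => g i y) = fun y => f y 0 := by
      ext y; congr 1; exact Subsingleton.elim _ _
    rw [this]
    exact (ContinuousAlternatingMap.apply ℝ V ℝ 0).contDiff.contDiffAt.comp x hf
  | succ r ih =>
    have hC : ContDiff ℝ n (fun P : AltForm V (r + 1) => P.curryLeft) := by
      apply IsBoundedLinearMap.contDiff
      refine ⟨⟨ContinuousAlternatingMap.curryLeft_add, ContinuousAlternatingMap.curryLeft_smul⟩,
        1, one_pos, fun P => ?_⟩
      rw [ContinuousAlternatingMap.norm_curryLeft, one_mul]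
    have h1 : ContDiffAt ℝ n (fun y => (f y).curryLeft) x := hC.contDiffAt.comp x hf
    have h2 := ih (h1.clm_apply (hg 0)) fun i => hg i.succ
    convert! h2 using 2 with y
    rw [ContinuousAlternatingMap.curryLeft_apply_apply]
    congr 1
    ext i
    refine Fin.cases ?_ (fun i => ?_) i <;> rfl

end FiniteDimensionalCalculus

/-! ### Permutation sums for the two halves of the bracket. -/

section Evaluation

variable {V F G : Type*} [NormedAddCommGroup V] [NormedSpace ℝ V]
  [NormedAddCommGroup F] [NormedSpace ℝ F] [NormedAddCommGroup G] [NormedSpace ℝ G]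

theorem wedgePairing_apply {p q n : ℕ} (h : p + q = n) (B : F →L[ℝ] G →L[ℝ] ℝ)
    (a : V [⋀^Fin p]→L[ℝ] F) (b : V [⋀^Fin q]→L[ℝ] G) (v : Fin n → V) :
    wedgePairing h B a b v = (p.factorial * q.factorial : ℝ)⁻¹ *
      ∑ σ : Equiv.Perm (Fin n), ((Equiv.Perm.sign σ : ℤ) : ℝ) *
        B (a fun i => v (σ (Fin.cast h (Fin.castAdd q i))))
          (b fun j => v (σ (Fin.cast h (Fin.natAdd p j)))) := by
  simp only [wedgePairing, ContinuousAlternatingMap.smul_apply, smul_eq_mul,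
    ContinuousMultilinearMap.alternatization_apply_apply]
  congr 1
  refine Finset.sum_congr rfl fun σ _ => ?_
  rw [Units.smul_def, zsmul_eq_mul]
  rfl

theorem freeFirst_apply {p : ℕ} (P : AltForm V (p + 1)) (v : Fin p → V) (α : V) :
    freeFirst P v α = P (Fin.cons α v) := rfl

theorem diffAt_apply {E : Type*} [NormedAddCommGroup E] [NormedSpace ℝ E] {p : ℕ}
    (P : E → AltForm V p) (x : E) (v : Fin p → V) (u : E) :
    diffAt P x v u = fderiv ℝ P x u v := rfl

/-- The factor `(-1) ^ p` moves the free slot of `P` from last to first, so that both halves insert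
the differential by `Fin.cons`. -/
theorem schoutenLeftPart_apply {E : Type*} [NormedAddCommGroup E] [NormedSpace ℝ E]
    {p q n : ℕ} (h : p + q = n) (P : E → Multivector E (p + 1)) (Q : E → Multivector E q) (x : E)
    (v : Fin n → (E →L[ℝ] ℝ)) :
    schoutenLeftPart h P Q x v = (p.factorial * q.factorial : ℝ)⁻¹ *
      ∑ σ : Equiv.Perm (Fin n), ((Equiv.Perm.sign σ : ℤ) : ℝ) * ((-1) ^ p *
        P x (Fin.cons (diffAt Q x fun j => v (σ (Fin.cast h (Fin.natAdd p j))))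
          fun i => v (σ (Fin.cast h (Fin.castAdd q i))))) :=
  wedgePairing_apply _ _ _ _ _

theorem schoutenRightPart_apply {E : Type*} [NormedAddCommGroup E] [NormedSpace ℝ E]
    {p q n : ℕ} (h : p + q = n) (P : E → Multivector E p) (Q : E → Multivector E (q + 1)) (x : E)
    (v : Fin n → (E →L[ℝ] ℝ)) :
    schoutenRightPart h P Q x v = (p.factorial * q.factorial : ℝ)⁻¹ *
      ∑ σ : Equiv.Perm (Fin n), ((Equiv.Perm.sign σ : ℤ) : ℝ) *
        Q x (Fin.cons (diffAt P x fun i => v (σ (Fin.cast h (Fin.castAdd q i))))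
          fun j => v (σ (Fin.cast h (Fin.natAdd p j)))) :=
  wedgePairing_apply _ _ _ _ _

end Evaluation

section Curves

theorem HasDerivAt.altForm_apply {V : Type*} [NormedAddCommGroup V] [NormedSpace ℝ V] {r : ℕ}
    {f : ℝ → AltForm V r} {f' : AltForm V r} {g : Fin r → ℝ → V} {g' : Fin r → V} {t : ℝ}
    (hf : HasDerivAt f f' t) (hg : ∀ i, HasDerivAt (g i) (g' i) t) :
    HasDerivAt (fun s => f s fun i => g i s)
      (f' (fun i => g i t) + ∑ i, f t (Function.update (fun i => g i t) i (g' i))) t := by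
  have h := (HasFDerivAt.continuousAlternatingMap_apply hf.hasFDerivAt
    fun i => (hg i).hasFDerivAt).hasDerivAt
  convert! h using 1
  simp

end Curves

/-! ### The tangent lift on a vector space. -/

section TangentLift

variable {E : Type*} [NormedAddCommGroup E] [NormedSpace ℝ E]

theorem covectorCurve_apply (t : ℝ) (a : (E × E) →L[ℝ] ℝ) :
    covectorCurve E t a = a.comp (ContinuousLinearMap.inr ℝ E E) +
      t • a.comp (ContinuousLinearMap.inl ℝ E E) := rfl

theorem covectorCurve_zero_apply (a : (E × E) →L[ℝ] ℝ) :
    covectorCurve E 0 a = a.comp (ContinuousLinearMap.inr ℝ E E) := by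
  simp [covectorCurve_apply]

theorem hasDerivAt_covectorCurve (a : (E × E) →L[ℝ] ℝ) (t : ℝ) :
    HasDerivAt (fun s => covectorCurve E s a) (a.comp (ContinuousLinearMap.inl ℝ E E)) t := by
  simp only [covectorCurve_apply]
  simpa using ((hasDerivAt_id t).smul_const (a.comp (ContinuousLinearMap.inl ℝ E E))).const_add
    (a.comp (ContinuousLinearMap.inr ℝ E E))

theorem hasDerivAt_line (x u : E) (t : ℝ) : HasDerivAt (fun s : ℝ => x + s • u) u t := by
  simpa using ((hasDerivAt_id t).smul_const u).const_add x

theorem hasDerivAt_comp_line {W : Type*} [NormedAddCommGroup W] [NormedSpace ℝ W] {f : E → W}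
    {x : E} (hf : DifferentiableAt ℝ f x) (u : E) :
    HasDerivAt (fun s : ℝ => f (x + s • u)) (fderiv ℝ f x u) 0 := by
  have h : HasFDerivAt f (fderiv ℝ f x) (x + (0 : ℝ) • u) := by simpa using hf.hasFDerivAt
  exact h.comp_hasDerivAt 0 (hasDerivAt_line x u 0)

theorem hasDerivAt_tangentLiftVS {r : ℕ} {P : E → Multivector E r} {z : E × E}
    (hP : DifferentiableAt ℝ P z.1) (a : Fin r → ((E × E) →L[ℝ] ℝ)) :
    HasDerivAt (fun t : ℝ => P (z.1 + t • z.2) fun i => covectorCurve E t (a i))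
      (tangentLiftVS P z a) 0 := by
  have hT : DifferentiableAt ℝ (fun t : ℝ => covectorCurve E t) 0 := by
    let A : ((E × E) →L[ℝ] ℝ) →L[ℝ] (E →L[ℝ] ℝ) :=
      ContinuousLinearMap.precomp ℝ (ContinuousLinearMap.inr ℝ E E)
    let B : ((E × E) →L[ℝ] ℝ) →L[ℝ] (E →L[ℝ] ℝ) :=
      ContinuousLinearMap.precomp ℝ (ContinuousLinearMap.inl ℝ E E)
    exact (hasDerivAt_line A B 0).differentiableAt
  have h : HasDerivAt (F := Multivector (E × E) r)
      (fun t : ℝ => (P (z.1 + t • z.2)).compContinuousLinearMap (covectorCurve E t))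
      (tangentLiftVS P z) (0 : ℝ) :=
    ((hasDerivAt_comp_line hP z.2).differentiableAt
      |>.continuousAlternatingMapCompContinuousLinearMap hT).hasDerivAt
  exact (ContinuousAlternatingMap.apply ℝ ((E × E) →L[ℝ] ℝ) ℝ a).hasFDerivAt.comp_hasDerivAt 0 h

/-- Leibniz rule: the base point moves with velocity `ẋ` and each covector `ϖ` with velocity `π`.
This is the local coordinate formula for `d_T`. -/
theorem tangentLiftVS_apply {r : ℕ} {P : E → Multivector E r} {z : E × E}
    (hP : DifferentiableAt ℝ P z.1) (a : Fin r → ((E × E) →L[ℝ] ℝ)) :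
    tangentLiftVS P z a =
      fderiv ℝ P z.1 z.2 (fun i => (a i).comp (ContinuousLinearMap.inr ℝ E E)) +
      ∑ i, P z.1 (Function.update (fun i => (a i).comp (ContinuousLinearMap.inr ℝ E E)) i
        ((a i).comp (ContinuousLinearMap.inl ℝ E E))) := by
  have h := (hasDerivAt_comp_line hP z.2).altForm_apply
    fun i => hasDerivAt_covectorCurve (a i) 0
  simpa [covectorCurve_zero_apply] using (hasDerivAt_tangentLiftVS hP a).unique h

/-- The tangent lift computes the derivative of the fibrewise multilinear function of `P` along any
curve of covectors whose velocity corresponds to `a`. -/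
theorem hasDerivAt_apply_curve {r : ℕ} {P : E → Multivector E r} {z : E × E}
    (hP : DifferentiableAt ℝ P z.1) {a : Fin r → ((E × E) →L[ℝ] ℝ)} {γ : ℝ → E}
    {c : Fin r → ℝ → (E →L[ℝ] ℝ)} (hγ0 : γ 0 = z.1) (hγ : HasDerivAt γ z.2 0)
    (hc0 : ∀ i, c i 0 = (a i).comp (ContinuousLinearMap.inr ℝ E E))
    (hc : ∀ i, HasDerivAt (c i) ((a i).comp (ContinuousLinearMap.inl ℝ E E)) 0) :
    HasDerivAt (fun t => P (γ t) fun i => c i t) (tangentLiftVS P z a) 0 := by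
  have h : HasFDerivAt P (fderiv ℝ P z.1) (γ 0) := by rw [hγ0]; exact hP.hasFDerivAt
  have h1 := (h.comp_hasDerivAt 0 hγ).altForm_apply hc
  rw [tangentLiftVS_apply hP a]
  simpa [hγ0, hc0] using h1

theorem tangentLiftVS_congr {r : ℕ} {P Q : E → Multivector E r} {z : E × E}
    (h : P =ᶠ[𝓝 z.1] Q) : tangentLiftVS P z = tangentLiftVS Q z := by
  refine Filter.EventuallyEq.deriv_eq ?_
  have h0 : Filter.Tendsto (fun t : ℝ => z.1 + t • z.2) (𝓝 0) (𝓝 z.1) := by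
    simpa using (hasDerivAt_line z.1 z.2 0).continuousAt.tendsto
  filter_upwards [h0.eventually h] with t ht
  rw [ht]

theorem tangentLiftVS_sub {r : ℕ} {P Q : E → Multivector E r} {z : E × E}
    (hP : DifferentiableAt ℝ P z.1) (hQ : DifferentiableAt ℝ Q z.1) :
    tangentLiftVS (fun x => P x - Q x) z = tangentLiftVS P z - tangentLiftVS Q z := by
  ext a
  have h := (hasDerivAt_tangentLiftVS hP a).sub (hasDerivAt_tangentLiftVS hQ a)
  exact (hasDerivAt_tangentLiftVS (hP.sub hQ) a).unique h

theorem tangentLiftVS_neg {r : ℕ} {P : E → Multivector E r} {z : E × E}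
    (hP : DifferentiableAt ℝ P z.1) :
    tangentLiftVS (fun x => -P x) z = -tangentLiftVS P z := by
  ext a
  exact (hasDerivAt_tangentLiftVS hP.neg a).unique (hasDerivAt_tangentLiftVS hP a).neg

theorem tangentLiftVS_zero {r : ℕ} (z : E × E) :
    tangentLiftVS (fun _ => (0 : Multivector E r)) z = 0 := by
  ext a
  exact (hasDerivAt_tangentLiftVS (differentiableAt_const _) a).unique (hasDerivAt_const 0 0)

end TangentLift

/-! ### Smoothness of lifts and brackets, with loss of one derivative. -/

section Smoothness

variable {E : Type*} [NormedAddCommGroup E] [NormedSpace ℝ E] [FiniteDimensional ℝ E]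

theorem contDiffAt_tangentLiftVS {r : ℕ} {n : ℕ∞ω} {P : E → Multivector E r} {z : E × E}
    (hP : ContDiffAt ℝ (n + 1) P z.1) : ContDiffAt ℝ n (tangentLiftVS P) z := by
  -- Being `C¹` is an open condition, so the explicit formula for the lift holds on a neighbourhood
  -- of `z`.
  have hd : ∀ᶠ w in 𝓝 z, DifferentiableAt ℝ P w.1 :=
    continuousAt_fst.eventually
      (((hP.of_le le_add_self).eventually (by simp)).mono fun y hy => hy.differentiableAt (by simp))
  rw [contDiffAt_altForm]
  intro a
  have h0 : ContDiffAt ℝ n (fun w : E × E => P w.1) z :=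
    ContDiffAt.comp z (hP.of_le le_self_add) contDiffAt_fst
  have h1 : ContDiffAt ℝ n (fun w : E × E => fderiv ℝ P w.1 w.2) z :=
    (ContDiffAt.comp z (hP.fderiv_right le_rfl) contDiffAt_fst).clm_apply contDiffAt_snd
  refine ContDiffAt.congr_of_eventuallyEq ?_ (hd.mono fun w hw => tangentLiftVS_apply hw a)
  refine (contDiffAt_altForm.1 h1 _).add (ContDiffAt.sum fun i _ => ?_)
  exact contDiffAt_altForm.1 h0 _

theorem contDiffAt_diffAt_apply {V : Type*} [NormedAddCommGroup V] [NormedSpace ℝ V]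
    [FiniteDimensional ℝ V] {X : Type*} [NormedAddCommGroup X] [NormedSpace ℝ X]
    {r : ℕ} {n : ℕ∞ω} {P : E → AltForm V r} {f : X → E} {g : Fin r → X → V} {x : X}
    (hP : ContDiffAt ℝ (n + 1) P (f x)) (hf : ContDiffAt ℝ n f x)
    (hg : ∀ i, ContDiffAt ℝ n (g i) x) :
    ContDiffAt ℝ n (fun y => diffAt P (f y) fun i => g i y) x := by
  refine contDiffAt_of_separating
    (fun u : E => (ContinuousLinearMap.apply ℝ ℝ u).toLinearMap) (fun w hw => ?_) fun u => ?_
  · ext u; exact hw u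
  · have h1 : ContDiffAt ℝ n (fun y => fderiv ℝ P (f y)) x :=
      ContDiffAt.comp x (hP.fderiv_right le_rfl) hf
    exact ContDiffAt.altForm_apply (h1.clm_apply contDiffAt_const) hg

theorem contDiffAt_schoutenLeftPart {p q m : ℕ} (h : p + q = m) {n : ℕ∞ω}
    {P : E → Multivector E (p + 1)} {Q : E → Multivector E q} {x : E}
    (hP : ContDiffAt ℝ n P x) (hQ : ContDiffAt ℝ (n + 1) Q x) :
    ContDiffAt ℝ n (schoutenLeftPart h P Q) x := by
  rw [contDiffAt_altForm]
  intro v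
  simp only [schoutenLeftPart_apply]
  refine contDiffAt_const.mul (ContDiffAt.sum fun σ _ => contDiffAt_const.mul
    (contDiffAt_const.mul (hP.altForm_apply (Fin.cases ?_ fun i => ?_))))
  · exact contDiffAt_diffAt_apply hQ contDiffAt_id fun _ => contDiffAt_const
  · exact contDiffAt_const

theorem contDiffAt_schoutenRightPart {p q m : ℕ} (h : p + q = m) {n : ℕ∞ω}
    {P : E → Multivector E p} {Q : E → Multivector E (q + 1)} {x : E}
    (hP : ContDiffAt ℝ (n + 1) P x) (hQ : ContDiffAt ℝ n Q x) :
    ContDiffAt ℝ n (schoutenRightPart h P Q) x := by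
  rw [contDiffAt_altForm]
  intro v
  simp only [schoutenRightPart_apply]
  refine contDiffAt_const.mul (ContDiffAt.sum fun σ _ => contDiffAt_const.mul
    (hQ.altForm_apply (Fin.cases ?_ fun i => ?_)))
  · exact contDiffAt_diffAt_apply hP contDiffAt_id fun _ => contDiffAt_const
  · exact contDiffAt_const

theorem contDiffAt_schoutenVS {p q : ℕ} {n : ℕ∞ω} {P : E → Multivector E p}
    {Q : E → Multivector E q} {x : E} (hP : ContDiffAt ℝ (n + 1) P x)
    (hQ : ContDiffAt ℝ (n + 1) Q x) : ContDiffAt ℝ n (schoutenVS P Q) x := by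
  match p, q, P, Q with
  | 0, 0, P, Q => exact contDiffAt_const
  | p + 1, 0, P, Q => exact contDiffAt_schoutenLeftPart _ (hP.of_le le_self_add) hQ
  | 0, q + 1, P, Q => exact (contDiffAt_schoutenRightPart _ hP (hQ.of_le le_self_add)).neg
  | p + 1, q + 1, P, Q =>
    exact (contDiffAt_schoutenLeftPart _ (hP.of_le le_self_add) hQ).sub
      (contDiffAt_schoutenRightPart _ hP (hQ.of_le le_self_add))

end Smoothness

/-! ### The bracket depends only on germs. -/

section Congruence

variable {E : Type*} [NormedAddCommGroup E] [NormedSpace ℝ E]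

theorem diffAt_congr {V : Type*} [NormedAddCommGroup V] [NormedSpace ℝ V] {r : ℕ}
    {P Q : E → AltForm V r} {x : E} (h : P =ᶠ[𝓝 x] Q) : diffAt P x = diffAt Q x := by
  unfold diffAt
  rw [h.fderiv_eq]

theorem schoutenVS_congr {p q : ℕ} {P P' : E → Multivector E p} {Q Q' : E → Multivector E q}
    {x : E} (hP : P =ᶠ[𝓝 x] P') (hQ : Q =ᶠ[𝓝 x] Q') :
    schoutenVS P Q x = schoutenVS P' Q' x := by
  match p, q, P, Q, P', Q' with
  | 0, 0, P, Q, P', Q' => rfl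
  | p + 1, 0, P, Q, P', Q' =>
    simp only [schoutenVS, schoutenLeftPart, hP.eq_of_nhds, diffAt_congr hQ]
  | 0, q + 1, P, Q, P', Q' =>
    simp only [schoutenVS, schoutenRightPart, hQ.eq_of_nhds, diffAt_congr hP]
  | p + 1, q + 1, P, Q, P', Q' =>
    simp only [schoutenVS, schoutenLeftPart, schoutenRightPart, hP.eq_of_nhds, hQ.eq_of_nhds,
      diffAt_congr hP, diffAt_congr hQ]

end Congruence

/-! ### Commutation of the lift with the bracket on a vector space. -/

section Commutation

variable {E : Type*} [NormedAddCommGroup E] [NormedSpace ℝ E] [FiniteDimensional ℝ E]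

theorem HasDerivAt.altForm_apply_const {V : Type*} [NormedAddCommGroup V] [NormedSpace ℝ V] {r : ℕ}
    {f : ℝ → AltForm V r} {f' : AltForm V r} {t : ℝ} (hf : HasDerivAt f f' t) (v : Fin r → V) :
    HasDerivAt (fun s => f s v) (f' v) t :=
  (ContinuousAlternatingMap.apply ℝ V ℝ v).hasFDerivAt.comp_hasDerivAt t hf

theorem HasDerivAt.clm_apply_const {V W : Type*} [NormedAddCommGroup V] [NormedSpace ℝ V]
    [NormedAddCommGroup W] [NormedSpace ℝ W]
    {f : ℝ → V →L[ℝ] W} {f' : V →L[ℝ] W} {t : ℝ} (hf : HasDerivAt f f' t) (v : V) :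
    HasDerivAt (fun s => f s v) (f' v) t := by
  simpa using hf.clm_apply (hasDerivAt_const t v)

theorem contDiffAt_line {W : Type*} [NormedAddCommGroup W] [NormedSpace ℝ W] {n : ℕ∞ω}
    (x u : W) (t : ℝ) : ContDiffAt ℝ n (fun s : ℝ => x + s • u) t :=
  contDiffAt_const.add (contDiffAt_id.smul contDiffAt_const)

theorem hasDerivAt_fderiv_line {X W : Type*} [NormedAddCommGroup X] [NormedSpace ℝ X]
    [NormedAddCommGroup W] [NormedSpace ℝ W] {f : X → W} {x : X}
    (hf : DifferentiableAt ℝ (fderiv ℝ f) x) (u v v' : X) :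
    HasDerivAt (fun s : ℝ => fderiv ℝ f (x + s • u) (v + s • v'))
      (fderiv ℝ (fderiv ℝ f) x u v + fderiv ℝ f x v') 0 := by
  simpa using (hasDerivAt_comp_line hf u).clm_apply (hasDerivAt_line v v' 0)

theorem hasDerivAt_fderiv_line_const {X W : Type*} [NormedAddCommGroup X] [NormedSpace ℝ X]
    [NormedAddCommGroup W] [NormedSpace ℝ W] {f : X → W} {x : X}
    (hf : DifferentiableAt ℝ (fderiv ℝ f) x) (u v : X) :
    HasDerivAt (fun s : ℝ => fderiv ℝ f (x + s • u) v) (fderiv ℝ (fderiv ℝ f) x u v) 0 :=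
  (hasDerivAt_comp_line hf u).clm_apply_const v

theorem differentiableAt_fderiv {X W : Type*} [NormedAddCommGroup X] [NormedSpace ℝ X]
    [NormedAddCommGroup W] [NormedSpace ℝ W] {f : X → W} {x : X}
    (hf : ContDiffAt ℝ (1 + 1) f x) : DifferentiableAt ℝ (fderiv ℝ f) x :=
  (hf.fderiv_right le_rfl).differentiableAt one_ne_zero

/-- Obtained by differentiating the explicit formula along `s ↦ z + s • w`: `w.1` moves the base
point, and `w.2` moves `ẋ`, which enters linearly in the first term only. -/
theorem fderiv_tangentLiftVS_apply {q : ℕ} {Q : E → Multivector E q} {z : E × E}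
    (hQ : ContDiffAt ℝ 2 Q z.1) (w : E × E) (a : Fin q → ((E × E) →L[ℝ] ℝ)) :
    fderiv ℝ (tangentLiftVS Q) z w a =
      (fderiv ℝ (fderiv ℝ Q) z.1 w.1 z.2 + fderiv ℝ Q z.1 w.2)
        (fun i => (a i).comp (ContinuousLinearMap.inr ℝ E E)) +
      ∑ i, fderiv ℝ Q z.1 w.1
        (Function.update (fun i => (a i).comp (ContinuousLinearMap.inr ℝ E E)) i
          ((a i).comp (ContinuousLinearMap.inl ℝ E E))) := by
  have hQ' : ContDiffAt ℝ (1 + 1) Q z.1 := by rwa [one_add_one_eq_two]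
  have hdT : DifferentiableAt ℝ (tangentLiftVS Q) z :=
    (contDiffAt_tangentLiftVS hQ').differentiableAt one_ne_zero
  have hdQ : DifferentiableAt ℝ Q z.1 := hQ.differentiableAt two_ne_zero
  have hddQ : DifferentiableAt ℝ (fderiv ℝ Q) z.1 :=
    differentiableAt_fderiv hQ'
  have h1 := (hasDerivAt_comp_line hdT w).altForm_apply_const a
  have hev : ∀ᶠ s : ℝ in 𝓝 0, DifferentiableAt ℝ Q (z.1 + s • w.1) := by
    have h0 : Filter.Tendsto (fun t : ℝ => z.1 + t • w.1) (𝓝 0) (𝓝 z.1) := by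
      simpa using (hasDerivAt_line z.1 w.1 0).continuousAt.tendsto
    exact h0.eventually ((hQ.eventually (by simp)).mono fun y hy => hy.differentiableAt two_ne_zero)
  have h2 := hasDerivAt_fderiv_line hddQ w.1 z.2 w.2
  have h3 := (h2.altForm_apply_const
    (fun i => (a i).comp (ContinuousLinearMap.inr ℝ E E))).add
    (HasDerivAt.fun_sum (u := Finset.univ) fun i _ =>
      (hasDerivAt_comp_line hdQ w.1).altForm_apply_const
      (Function.update (fun i => (a i).comp (ContinuousLinearMap.inr ℝ E E)) i
          ((a i).comp (ContinuousLinearMap.inl ℝ E E))))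
  refine h1.unique (h3.congr_of_eventuallyEq (hev.mono fun s hs => ?_))
  exact tangentLiftVS_apply (z := z + s • w) hs a

/-- The lift is affine in `ẋ` with slope the differential of `Q`. This gives the value at `0` of the
curve of covectors whose velocity is found next. -/
theorem diffAt_tangentLiftVS_comp_inr {q : ℕ} {Q : E → Multivector E q} {z : E × E}
    (hQ : ContDiffAt ℝ 2 Q z.1) (a : Fin q → ((E × E) →L[ℝ] ℝ)) :
    (diffAt (tangentLiftVS Q) z a).comp (ContinuousLinearMap.inr ℝ E E) =
      diffAt Q z.1 fun i => (a i).comp (ContinuousLinearMap.inr ℝ E E) := by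
  ext u
  rw [ContinuousLinearMap.comp_apply, diffAt_apply, fderiv_tangentLiftVS_apply hQ]
  simp [diffAt_apply]

/-- The core of the commutation: the canonical isomorphism sends the differential of `d_T Q` on `a`
to the velocity of the curve of differentials of `Q`. -/
theorem hasDerivAt_diffAt_covectorCurve {q : ℕ} {Q : E → Multivector E q} {z : E × E}
    (hQ : ContDiffAt ℝ 2 Q z.1) (a : Fin q → ((E × E) →L[ℝ] ℝ)) :
    HasDerivAt (fun t : ℝ => diffAt Q (z.1 + t • z.2) fun i => covectorCurve E t (a i))
      ((diffAt (tangentLiftVS Q) z a).comp (ContinuousLinearMap.inl ℝ E E)) 0 := by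
  have hQ' : ContDiffAt ℝ (1 + 1) Q z.1 := by rwa [one_add_one_eq_two]
  have hddQ : DifferentiableAt ℝ (fderiv ℝ Q) z.1 :=
    differentiableAt_fderiv hQ'
  have hc : ∀ i, ContDiffAt ℝ 1 (fun t : ℝ => covectorCurve E t (a i)) 0 := fun i =>
    contDiffAt_line _ _ 0
  -- Once the covector-valued curve is known to be differentiable, its derivative can be identified
  -- on each fixed vector `u`.
  have hd := ((contDiffAt_diffAt_apply (f := fun t : ℝ => z.1 + t • z.2) (x := (0 : ℝ))
    (by simpa using hQ') (contDiffAt_line z.1 z.2 0) hc).differentiableAt one_ne_zero).hasDerivAt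
  refine hd.congr_deriv (ContinuousLinearMap.ext fun u => ?_)
  refine (hd.clm_apply_const u).unique ?_
  have h := (hasDerivAt_fderiv_line_const hddQ z.2 u).altForm_apply
    fun i => hasDerivAt_covectorCurve (a i) 0
  convert! h using 1
  rw [ContinuousLinearMap.comp_apply, diffAt_apply, fderiv_tangentLiftVS_apply hQ]
  -- The curve yields `D²Q(ẋ, u)`, the lift yields `D²Q(u, ẋ)`.
  have hs := (hQ.isSymmSndFDerivAt (by simp)).eq u z.2
  simp [covectorCurve_zero_apply, hs]

/-- Each argument of `P` moves along a curve of covectors, one of them being a differential of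
`Q`. -/
theorem hasDerivAt_apply_cons_diffAt {p q : ℕ} {P : E → Multivector E (p + 1)}
    {Q : E → Multivector E q} {z : E × E} (hP : DifferentiableAt ℝ P z.1)
    (hQ : ContDiffAt ℝ 2 Q z.1) (a : Fin p → ((E × E) →L[ℝ] ℝ))
    (b : Fin q → ((E × E) →L[ℝ] ℝ)) :
    HasDerivAt (fun t : ℝ => P (z.1 + t • z.2)
        (Fin.cons (diffAt Q (z.1 + t • z.2) fun j => covectorCurve E t (b j))
          fun i => covectorCurve E t (a i)))
      (tangentLiftVS P z (Fin.cons (diffAt (tangentLiftVS Q) z b) a)) 0 := by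
  have h := hasDerivAt_apply_curve (P := P) (z := z) hP
    (a := Fin.cons (diffAt (tangentLiftVS Q) z b) a) (γ := fun t : ℝ => z.1 + t • z.2)
    (c := fun i t => (Fin.cons (diffAt Q (z.1 + t • z.2) fun j => covectorCurve E t (b j))
          (fun i => covectorCurve E t (a i)) : Fin (p + 1) → (E →L[ℝ] ℝ)) i)
    (by simp) (hasDerivAt_line z.1 z.2 0)
    (Fin.cases (by simp [covectorCurve_zero_apply, diffAt_tangentLiftVS_comp_inr hQ])
      fun i => by simp [covectorCurve_zero_apply])
    (Fin.cases (by simpa using hasDerivAt_diffAt_covectorCurve hQ b)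
      fun i => by simpa using hasDerivAt_covectorCurve (a i) 0)
  exact h

theorem schoutenLeftPart_tangentLiftVS {p q m : ℕ} (h : p + q = m) {P : E → Multivector E (p + 1)}
    {Q : E → Multivector E q} {z : E × E} (hP : ContDiffAt ℝ 2 P z.1)
    (hQ : ContDiffAt ℝ 2 Q z.1) :
    schoutenLeftPart h (tangentLiftVS P) (tangentLiftVS Q) z =
      tangentLiftVS (schoutenLeftPart h P Q) z := by
  have hL : DifferentiableAt ℝ (schoutenLeftPart h P Q) z.1 :=
    (contDiffAt_schoutenLeftPart h (n := 1) (hP.of_le one_le_two)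
      (by rwa [one_add_one_eq_two])).differentiableAt one_ne_zero
  ext a
  -- The lift of this half is its derivative along the covector curves; the coefficients of the
  -- permutation sum are constant, so it is computed term by term.
  refine HasDerivAt.unique ?_ (hasDerivAt_tangentLiftVS hL a)
  simp only [schoutenLeftPart_apply]
  refine HasDerivAt.const_mul _ (HasDerivAt.fun_sum fun σ _ => HasDerivAt.const_mul _
    (HasDerivAt.const_mul _ ?_))
  exact hasDerivAt_apply_cons_diffAt (hP.differentiableAt two_ne_zero) hQ _ _

theorem schoutenRightPart_tangentLiftVS {p q m : ℕ} (h : p + q = m) {P : E → Multivector E p}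
    {Q : E → Multivector E (q + 1)} {z : E × E} (hP : ContDiffAt ℝ 2 P z.1)
    (hQ : ContDiffAt ℝ 2 Q z.1) :
    schoutenRightPart h (tangentLiftVS P) (tangentLiftVS Q) z =
      tangentLiftVS (schoutenRightPart h P Q) z := by
  have hL : DifferentiableAt ℝ (schoutenRightPart h P Q) z.1 :=
    (contDiffAt_schoutenRightPart h (n := 1) (by rwa [one_add_one_eq_two])
      (hQ.of_le one_le_two)).differentiableAt one_ne_zero
  ext a
  refine HasDerivAt.unique ?_ (hasDerivAt_tangentLiftVS hL a)
  simp only [schoutenRightPart_apply]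
  refine HasDerivAt.const_mul _ (HasDerivAt.fun_sum fun σ _ => HasDerivAt.const_mul _ ?_)
  exact hasDerivAt_apply_cons_diffAt (hQ.differentiableAt two_ne_zero) hP _ _

/-- On a vector space, the tangent lift commutes with the Schouten bracket. -/
theorem schoutenVS_tangentLiftVS {p q : ℕ} {P : E → Multivector E p} {Q : E → Multivector E q}
    {z : E × E} (hP : ContDiffAt ℝ 2 P z.1) (hQ : ContDiffAt ℝ 2 Q z.1) :
    schoutenVS (tangentLiftVS P) (tangentLiftVS Q) z = tangentLiftVS (schoutenVS P Q) z := by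
  have e : (2 : ℕ∞ω) = 1 + 1 := one_add_one_eq_two.symm
  have hP1 : ContDiffAt ℝ 1 P z.1 := hP.of_le one_le_two
  have hQ1 : ContDiffAt ℝ 1 Q z.1 := hQ.of_le one_le_two
  match p, q, P, Q with
  | 0, 0, P, Q => exact (tangentLiftVS_zero z).symm
  | p + 1, 0, P, Q => exact schoutenLeftPart_tangentLiftVS _ hP hQ
  | 0, q + 1, P, Q =>
    refine (congrArg Neg.neg (schoutenRightPart_tangentLiftVS (by omega) hP hQ)).trans
      (tangentLiftVS_neg ?_).symm
    exact (contDiffAt_schoutenRightPart _ (e ▸ hP) hQ1).differentiableAt one_ne_zero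
  | p + 1, q + 1, P, Q =>
    refine (congrArg₂ (· - ·) (schoutenLeftPart_tangentLiftVS (by omega) hP hQ)
      (schoutenRightPart_tangentLiftVS (by omega) hP hQ)).trans (tangentLiftVS_sub ?_ ?_).symm
    · exact (contDiffAt_schoutenLeftPart _ hP1 (e ▸ hQ)).differentiableAt one_ne_zero
    · exact (contDiffAt_schoutenRightPart _ (e ▸ hP) hQ1).differentiableAt one_ne_zero

end Commutation

/-! ### Moving slots inside signed sums over permutations. -/

section Shuffles

/-- Reindexing a signed sum over permutations by a transposition. -/
theorem sum_sign_mul_swap {n : ℕ} (x y : Fin n) {f g : Equiv.Perm (Fin n) → ℝ}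
    (hfg : ∀ σ, f σ = ((Equiv.Perm.sign (Equiv.swap x y) : ℤ) : ℝ) * g (σ * Equiv.swap x y)) :
    ∑ σ, ((Equiv.Perm.sign σ : ℤ) : ℝ) * f σ = ∑ σ, ((Equiv.Perm.sign σ : ℤ) : ℝ) * g σ := by
  refine Fintype.sum_equiv (Equiv.mulRight (Equiv.swap x y)) _ _ fun σ => ?_
  simp only [hfg, Equiv.coe_mulRight, Equiv.Perm.sign_mul, Units.val_mul, Int.cast_mul]
  ring

theorem sign_swap_embedding {k n : ℕ} {f : Fin k → Fin n} (hf : Function.Injective f)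
    (i j : Fin k) :
    Equiv.Perm.sign (Equiv.swap (f i) (f j)) = Equiv.Perm.sign (Equiv.swap i j) := by
  simp [Equiv.Perm.sign_swap', hf.eq_iff]

variable {V : Type*} [NormedAddCommGroup V] [NormedSpace ℝ V]

theorem toContinuousLinearMap_swap {k : ℕ} (B : AltForm V k) (w : Fin k → V) (i j : Fin k) :
    B.toContinuousLinearMap w j = ((Equiv.Perm.sign (Equiv.swap i j) : ℤ) : ℝ) •
      B.toContinuousLinearMap (w ∘ Equiv.swap i j) i := by
  ext X
  have h := B.toAlternatingMap.map_perm (Function.update w j X) (Equiv.swap i j)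
  rw [Function.update_comp_equiv, Equiv.symm_swap, Equiv.swap_apply_right] at h
  have h' : B (Function.update (w ∘ Equiv.swap i j) i X) =
      ((Equiv.Perm.sign (Equiv.swap i j) : ℤ) : ℝ) * B (Function.update w j X) := by
    rw [← zsmul_eq_mul]; exact h
  simp only [ContinuousAlternatingMap.toContinuousLinearMap_apply, smul_apply,
    smul_eq_mul, h', ← mul_assoc, ← Int.cast_mul]
  simp

theorem toContinuousLinearMap_zero {k : ℕ} (B : AltForm V (k + 1)) (w : Fin (k + 1) → V) :
    B.toContinuousLinearMap w 0 = freeFirst B (fun i => w i.succ) := by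
  ext X
  rw [ContinuousAlternatingMap.toContinuousLinearMap_apply, freeFirst_apply]
  congr 1
  ext i
  refine Fin.cases ?_ (fun i => ?_) i <;> simp

theorem toContinuousLinearMap_last {k : ℕ} (B : AltForm V (k + 1)) (w : Fin (k + 1) → V) :
    B.toContinuousLinearMap w (Fin.last k) =
      ((-1 : ℝ) ^ k) • freeFirst B (fun i => w i.castSucc) := by
  ext X
  rw [ContinuousAlternatingMap.toContinuousLinearMap_apply, smul_apply,
    freeFirst_apply]
  -- Bringing the last entry to the front is a cycle of length `k + 1`, of sign `(-1) ^ k`.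
  have e : Function.update w (Fin.last k) X =
      (Fin.cons X (fun i => w i.castSucc) : Fin (k + 1) → V) ∘ finRotate (k + 1) := by
    have h := Fin.snoc_eq_cons_rotate (fun i : Fin k => w i.castSucc) X
    rw [Function.comp_def, ← h]
    ext i
    refine Fin.lastCases ?_ (fun i => ?_) i
    · simp
    · simp [(Fin.castSucc_lt_last i).ne]
  rw [e]
  have h := B.toAlternatingMap.map_perm
    (Fin.cons X (fun i => w i.castSucc) : Fin (k + 1) → V) (finRotate (k + 1))
  rw [sign_finRotate] at h
  refine h.trans ?_
  rw [Units.smul_def, zsmul_eq_mul]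
  simp

variable {E : Type*} [NormedAddCommGroup E] [NormedSpace ℝ E]

/-- The covector `u ↦ ∑ⱼ B (w₁, …, Sⱼ u, …, w_k)`. -/
noncomputable def slotSum {k : ℕ} (B : AltForm V k) (w : Fin k → V) (S : Fin k → (E →L[ℝ] V)) :
    E →L[ℝ] ℝ :=
  ∑ j, (B.toContinuousLinearMap w j).comp (S j)

theorem slotSum_apply {k : ℕ} (B : AltForm V k) (w : Fin k → V) (S : Fin k → (E →L[ℝ] V)) (u : E) :
    slotSum B w S u = ∑ j, B (Function.update w j (S j u)) := by
  simp [slotSum]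

/-- In a signed sum over permutations, all slots of `slotSum` contribute equally. -/
theorem sum_sign_mul_slotSum {k n : ℕ} {f : Fin k → Fin n} (hf : Function.Injective f)
    (B : AltForm V k) (v : Fin n → V) (S : Fin n → (E →L[ℝ] V))
    (T : Equiv.Perm (Fin n) → (E →L[ℝ] ℝ) →L[ℝ] ℝ)
    (hT : ∀ σ (i j : Fin k), T (σ * Equiv.swap (f i) (f j)) = T σ) (i : Fin k) :
    ∑ σ : Equiv.Perm (Fin n), ((Equiv.Perm.sign σ : ℤ) : ℝ) *
        T σ (slotSum B (fun l => v (σ (f l))) fun l => S (σ (f l))) =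
      k * ∑ σ : Equiv.Perm (Fin n), ((Equiv.Perm.sign σ : ℤ) : ℝ) *
        T σ ((B.toContinuousLinearMap (fun l => v (σ (f l))) i).comp (S (σ (f i)))) := by
  -- Reindexing by the transposition of `f i` and `f j` carries slot `j` to slot `i`; its sign
  -- cancels the sign from skew symmetry of `B`.
  have key : ∀ j : Fin k, ∑ σ : Equiv.Perm (Fin n), ((Equiv.Perm.sign σ : ℤ) : ℝ) *
        T σ ((B.toContinuousLinearMap (fun l => v (σ (f l))) j).comp (S (σ (f j)))) =
      ∑ σ : Equiv.Perm (Fin n), ((Equiv.Perm.sign σ : ℤ) : ℝ) *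
        T σ ((B.toContinuousLinearMap (fun l => v (σ (f l))) i).comp (S (σ (f i)))) := by
    intro j
    refine sum_sign_mul_swap (f i) (f j) fun σ => ?_
    have e : ((fun l => v (σ (f l))) ∘ Equiv.swap i j) =
        fun l => v ((σ * Equiv.swap (f i) (f j)) (f l)) := by
      ext l
      simp only [Function.comp_apply, Equiv.Perm.mul_apply, hf.swap_apply]
    rw [toContinuousLinearMap_swap B _ i j, e, hT, sign_swap_embedding hf,
      ContinuousLinearMap.smul_comp, map_smul, smul_eq_mul]
    simp
  simp only [slotSum, map_sum, Finset.mul_sum]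
  rw [Finset.sum_comm]
  simp only [key]
  simp [Finset.mul_sum]

end Shuffles

/-! ### Equality of the Hessian terms of the two halves. -/

section SymmetricPairing

variable {E : Type*} [NormedAddCommGroup E] [NormedSpace ℝ E] [FiniteDimensional ℝ E]

theorem exists_eq_apply_of_bidual (φ : (E →L[ℝ] ℝ) →L[ℝ] ℝ) : ∃ e : E, ∀ α, φ α = α e := by
  let ψ : Module.Dual ℝ (Module.Dual ℝ E) :=
    φ.toLinearMap ∘ₗ (LinearMap.toContinuousLinearMap : (E →ₗ[ℝ] ℝ) ≃ₗ[ℝ] (E →L[ℝ] ℝ)).toLinearMap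
  refine ⟨(Module.evalEquiv ℝ E).symm ψ, fun α => ?_⟩
  have h := Module.apply_evalEquiv_symm_apply ℝ E α.toLinearMap ψ
  exact h.symm

/-- By reflexivity `φ` and `χ` are evaluations at vectors `e` and `e'`, so the sides are `S e e'`
and `S e' e`. -/
theorem apply_comp_symm (φ χ : (E →L[ℝ] ℝ) →L[ℝ] ℝ) {S : E →L[ℝ] (E →L[ℝ] ℝ)}
    (hS : ∀ u w, S u w = S w u) : φ (χ.comp S) = χ (φ.comp S) := by
  obtain ⟨e, he⟩ := exists_eq_apply_of_bidual φ
  obtain ⟨e', he'⟩ := exists_eq_apply_of_bidual χ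
  simp [he, he', hS e e']

/-- The two second-order terms in the transformation law of the Schouten bracket agree. -/
theorem sum_slotSum_left_eq_right {p q n : ℕ} (hl : p + (q + 1) = n) (hr : p + 1 + q = n)
    (A : Multivector E (p + 1)) (B : Multivector E (q + 1)) (v : Fin n → (E →L[ℝ] ℝ))
    {S : Fin n → (E →L[ℝ] (E →L[ℝ] ℝ))} (hS : ∀ i u w, S i u w = S i w u) :
    (p.factorial * (q + 1).factorial : ℝ)⁻¹ *
      ∑ σ : Equiv.Perm (Fin n), ((Equiv.Perm.sign σ : ℤ) : ℝ) * ((-1) ^ p *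
        freeFirst A (fun i => v (σ (Fin.cast hl (Fin.castAdd (q + 1) i))))
          (slotSum B (fun j => v (σ (Fin.cast hl (Fin.natAdd p j))))
            fun j => S (σ (Fin.cast hl (Fin.natAdd p j))))) =
    ((p + 1).factorial * q.factorial : ℝ)⁻¹ *
      ∑ σ : Equiv.Perm (Fin n), ((Equiv.Perm.sign σ : ℤ) : ℝ) *
        freeFirst B (fun j => v (σ (Fin.cast hr (Fin.natAdd (p + 1) j))))
          (slotSum A (fun i => v (σ (Fin.cast hr (Fin.castAdd q i))))
            fun i => S (σ (Fin.cast hr (Fin.castAdd q i)))) := by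
  -- The sums are reduced to slot `0` of `B` here and to the last slot of `A` in `hR`. Both sit at
  -- position `p` among the `n`, so the remaining arguments match.
  have hL := sum_sign_mul_slotSum (f := fun j => Fin.cast hl (Fin.natAdd p j))
    (fun i j h => by simpa [Fin.ext_iff] using h) B v S
    (fun σ => (-1 : ℝ) ^ p • freeFirst A (fun i => v (σ (Fin.cast hl (Fin.castAdd (q + 1) i)))))
    (fun σ i j => by
      congr 2
      ext l : 1
      rw [Equiv.Perm.mul_apply, Equiv.swap_apply_of_ne_of_ne] <;>
        simp only [ne_eq, Fin.ext_iff, Fin.val_cast, Fin.val_natAdd, Fin.val_castAdd] <;> omega) 0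
  have hR := sum_sign_mul_slotSum (f := fun j => Fin.cast hr (Fin.castAdd q j))
    (fun i j h => by simpa [Fin.ext_iff] using h) A v S
    (fun σ => freeFirst B (fun j => v (σ (Fin.cast hr (Fin.natAdd (p + 1) j)))))
    (fun σ i j => by
      congr 1
      ext l : 1
      rw [Equiv.Perm.mul_apply, Equiv.swap_apply_of_ne_of_ne] <;>
        simp only [ne_eq, Fin.ext_iff, Fin.val_cast, Fin.val_natAdd, Fin.val_castAdd] <;> omega)
    (Fin.last p)
  simp only [smul_apply, smul_eq_mul] at hL
  rw [hL, hR, ← mul_assoc, ← mul_assoc]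
  congr 1
  -- The `q + 1`, respectively `p + 1`, equal slots turn both weights into `1 / (p! q!)`.
  · rw [Nat.factorial_succ, Nat.factorial_succ]
    push_cast
    have := Nat.factorial_ne_zero p
    have := Nat.factorial_ne_zero q
    field_simp
  · refine Finset.sum_congr rfl fun σ _ => ?_
    congr 1
    rw [toContinuousLinearMap_zero, toContinuousLinearMap_last, ContinuousLinearMap.smul_comp,
      map_smul, smul_eq_mul]
    congr 1
    rw [apply_comp_symm _ _ (hS _)]
    have e1 : ∀ i : Fin q, Fin.cast hl (Fin.natAdd p i.succ) = Fin.cast hr (Fin.natAdd (p + 1) i) :=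
      fun i => by ext; simp; omega
    have e2 : Fin.cast hl (Fin.natAdd p (0 : Fin (q + 1))) =
      Fin.cast hr (Fin.castAdd q (Fin.last p)) := by ext; simp
    have e3 : ∀ i : Fin p, Fin.cast hl (Fin.castAdd (q + 1) i) =
      Fin.cast hr (Fin.castAdd q i.castSucc) := fun i => by ext; simp
    simp only [e1, e2, e3]

end SymmetricPairing

/-! ### Naturality of the lift and the bracket under maps. -/

section Naturality

variable {E : Type*} [NormedAddCommGroup E] [NormedSpace ℝ E]
  {F : Type*} [NormedAddCommGroup F] [NormedSpace ℝ F]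

/-- The multivector field `P'` is, near `ψ x`, the push-forward of `P` by `ψ`. -/
def IsPushforwardAt {r : ℕ} (ψ : E → F) (P : E → Multivector E r) (P' : F → Multivector F r)
    (x : E) : Prop :=
  ∀ᶠ y in 𝓝 x, P' (ψ y) =
    (P y).compContinuousLinearMap (ContinuousLinearMap.precomp ℝ (fderiv ℝ ψ y))

theorem IsPushforwardAt.apply_eq {r : ℕ} {ψ : E → F} {P : E → Multivector E r}
    {P' : F → Multivector F r} {x : E} (h : IsPushforwardAt ψ P P' x)
    (v : Fin r → (F →L[ℝ] ℝ)) :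
    P' (ψ x) v = P x fun i => (v i).comp (fderiv ℝ ψ x) := by
  rw [h.self_of_nhds]; rfl

/-- The tangent map of `ψ`. -/
noncomputable def tangentMapVS (ψ : E → F) (z : E × E) : F × F := (ψ z.1, fderiv ℝ ψ z.1 z.2)

theorem hasFDerivAt_tangentMapVS {ψ : E → F} {z : E × E} (hψ : ContDiffAt ℝ 2 ψ z.1) :
    HasFDerivAt (tangentMapVS ψ)
      (((fderiv ℝ ψ z.1).comp (ContinuousLinearMap.fst ℝ E E)).prod
        ((fderiv ℝ ψ z.1).comp (ContinuousLinearMap.snd ℝ E E) +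
          ((fderiv ℝ (fderiv ℝ ψ) z.1).comp (ContinuousLinearMap.fst ℝ E E)).flip z.2)) z := by
  have h1 : HasFDerivAt (fun w : E × E => ψ w.1) _ z :=
    (hψ.differentiableAt two_ne_zero).hasFDerivAt.comp z hasFDerivAt_fst
  have h2 : HasFDerivAt (fun w : E × E => fderiv ℝ ψ w.1) _ z :=
    (differentiableAt_fderiv (by rwa [one_add_one_eq_two])).hasFDerivAt.comp z hasFDerivAt_fst
  exact h1.prodMk (h2.clm_apply hasFDerivAt_snd)

/-- The tangent lift is natural with respect to local diffeomorphisms. -/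
theorem tangentLiftVS_natural {r : ℕ} {ψ : E → F} {P : E → Multivector E r}
    {P' : F → Multivector F r} {z : E × E} (hψ : ContDiffAt ℝ 2 ψ z.1)
    (hP : DifferentiableAt ℝ P z.1) (hP' : DifferentiableAt ℝ P' (ψ z.1))
    (h : IsPushforwardAt ψ P P' z.1) :
    tangentLiftVS P' (tangentMapVS ψ z) = (tangentLiftVS P z).compContinuousLinearMap
      (ContinuousLinearMap.precomp ℝ (fderiv ℝ (tangentMapVS ψ) z)) := by
  have hdψ : DifferentiableAt ℝ ψ z.1 := hψ.differentiableAt two_ne_zero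
  have hddψ : DifferentiableAt ℝ (fderiv ℝ ψ) z.1 :=
    differentiableAt_fderiv (by rwa [one_add_one_eq_two])
  have hsymm := hψ.isSymmSndFDerivAt (by simp)
  have hT := (hasFDerivAt_tangentMapVS hψ).fderiv
  ext a
  have h1 : HasDerivAt (fun t : ℝ => P' (ψ (z.1 + t • z.2)) fun i => covectorCurve F t (a i))
      (tangentLiftVS P' (tangentMapVS ψ z) a) 0 :=
    hasDerivAt_apply_curve (z := tangentMapVS ψ z) hP' (by simp [tangentMapVS])
      (hasDerivAt_comp_line hdψ z.2) (fun i => covectorCurve_zero_apply _)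
      (fun i => hasDerivAt_covectorCurve _ 0)
  have h2 : HasDerivAt (fun t : ℝ => P (z.1 + t • z.2) fun i =>
        (covectorCurve F t (a i)).comp (fderiv ℝ ψ (z.1 + t • z.2)))
      (tangentLiftVS P z fun i => (a i).comp (fderiv ℝ (tangentMapVS ψ) z)) 0 := by
    refine hasDerivAt_apply_curve hP (γ := fun t : ℝ => z.1 + t • z.2) (c := fun i t =>
        (covectorCurve F t (a i)).comp (fderiv ℝ ψ (z.1 + t • z.2))) (by simp)
      (hasDerivAt_line z.1 z.2 0) (fun i => ?_) (fun i => ?_)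
    · rw [hT]
      ext u
      simp [covectorCurve_zero_apply]
    · refine ((hasDerivAt_covectorCurve (a i) 0).clm_comp
        (hasDerivAt_comp_line hddψ z.2)).congr_deriv ?_
      rw [hT]
      ext u
      -- The pulled-back covector varies by `D²ψ(ẋ, u)`, whereas the derivative of the tangent map
      -- contains `D²ψ(u, ẋ)`.
      simp [covectorCurve_zero_apply, hsymm.eq z.2 u, ← map_add]
  refine h1.unique (h2.congr_of_eventuallyEq ?_)
  have h0 : Filter.Tendsto (fun t : ℝ => z.1 + t • z.2) (𝓝 0) (𝓝 z.1) := by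
    simpa using (hasDerivAt_line z.1 z.2 0).continuousAt.tendsto
  filter_upwards [h0.eventually h] with t ht
  rw [ht]
  rfl

/-- `u ↦ β ∘ D²ψ(x)(u, ·)`. -/
noncomputable def covectorHessian (ψ : E → F) (x : E) (β : F →L[ℝ] ℝ) : E →L[ℝ] (E →L[ℝ] ℝ) :=
  (ContinuousLinearMap.compL ℝ E F ℝ β).comp (fderiv ℝ (fderiv ℝ ψ) x)

theorem covectorHessian_apply (ψ : E → F) (x : E) (β : F →L[ℝ] ℝ) (u w : E) :
    covectorHessian ψ x β u w = β (fderiv ℝ (fderiv ℝ ψ) x u w) := rfl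

/-- Constant covectors on `F` pull back to covectors varying with the point; differentiating them
adds one Hessian term per slot. -/
theorem diffAt_natural {r : ℕ} {ψ : E → F} {P : E → Multivector E r}
    {P' : F → Multivector F r} {x : E} (hψ : ContDiffAt ℝ 2 ψ x)
    (hP : DifferentiableAt ℝ P x) (hP' : DifferentiableAt ℝ P' (ψ x))
    (h : IsPushforwardAt ψ P P' x) (v : Fin r → (F →L[ℝ] ℝ)) :
    (diffAt P' (ψ x) v).comp (fderiv ℝ ψ x) =
      diffAt P x (fun i => (v i).comp (fderiv ℝ ψ x)) +
      slotSum (P x) (fun i => (v i).comp (fderiv ℝ ψ x)) fun i => covectorHessian ψ x (v i) := by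
  have hdψ : DifferentiableAt ℝ ψ x := hψ.differentiableAt two_ne_zero
  have hddψ : DifferentiableAt ℝ (fderiv ℝ ψ) x :=
    differentiableAt_fderiv (by rwa [one_add_one_eq_two])
  ext u
  have h1 : HasDerivAt (fun t : ℝ => P' (ψ (x + t • u)) v)
      (fderiv ℝ P' (ψ x) (fderiv ℝ ψ x u) v) 0 := by
    have h' : HasFDerivAt P' (fderiv ℝ P' (ψ x)) (ψ (x + (0 : ℝ) • u)) := by
      simpa using hP'.hasFDerivAt
    exact (h'.comp_hasDerivAt (0 : ℝ) (hasDerivAt_comp_line hdψ u)).altForm_apply_const v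
  have h2 := (hasDerivAt_comp_line hP u).altForm_apply fun i =>
    (hasDerivAt_const (0 : ℝ) (v i)).clm_comp (hasDerivAt_comp_line hddψ u)
  have h3 := h1.unique (h2.congr_of_eventuallyEq (by
    have h0 : Filter.Tendsto (fun t : ℝ => x + t • u) (𝓝 0) (𝓝 x) := by
      simpa using (hasDerivAt_line x u 0).continuousAt.tendsto
    filter_upwards [h0.eventually h] with t ht
    rw [ht]
    rfl))
  rw [ContinuousLinearMap.comp_apply, diffAt_apply, h3, add_apply, diffAt_apply, slotSum_apply]
  simp only [zero_smul, add_zero, ContinuousLinearMap.zero_comp, zero_add]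
  rfl

theorem IsPushforwardAt.apply_cons_eq {p : ℕ} {ψ : E → F} {P : E → Multivector E (p + 1)}
    {P' : F → Multivector F (p + 1)} {x : E} (h : IsPushforwardAt ψ P P' x)
    (α : F →L[ℝ] ℝ) (v : Fin p → (F →L[ℝ] ℝ)) :
    P' (ψ x) (Fin.cons α v) =
      freeFirst (P x) (fun i => (v i).comp (fderiv ℝ ψ x)) (α.comp (fderiv ℝ ψ x)) := by
  rw [h.apply_eq, freeFirst_apply]
  congr 1
  ext i : 1
  refine Fin.cases ?_ (fun i => ?_) i <;> simp

theorem schoutenLeftPart_natural {p q n : ℕ} (hn : p + q = n) {ψ : E → F}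
    {P : E → Multivector E (p + 1)} {P' : F → Multivector F (p + 1)}
    {Q : E → Multivector E q} {Q' : F → Multivector F q} {x : E} (hψ : ContDiffAt ℝ 2 ψ x)
    (hQ : DifferentiableAt ℝ Q x) (hQ' : DifferentiableAt ℝ Q' (ψ x))
    (hPP' : IsPushforwardAt ψ P P' x) (hQQ' : IsPushforwardAt ψ Q Q' x)
    (v : Fin n → (F →L[ℝ] ℝ)) :
    schoutenLeftPart hn P' Q' (ψ x) v =
      schoutenLeftPart hn P Q x (fun i => (v i).comp (fderiv ℝ ψ x)) +
      (p.factorial * q.factorial : ℝ)⁻¹ *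
      ∑ σ : Equiv.Perm (Fin n), ((Equiv.Perm.sign σ : ℤ) : ℝ) * ((-1) ^ p *
        freeFirst (P x)
          (fun i => (v (σ (Fin.cast hn (Fin.castAdd q i)))).comp (fderiv ℝ ψ x))
          (slotSum (Q x) (fun j => (v (σ (Fin.cast hn (Fin.natAdd p j)))).comp (fderiv ℝ ψ x))
            fun j => covectorHessian ψ x (v (σ (Fin.cast hn (Fin.natAdd p j)))))) := by
  simp only [schoutenLeftPart_apply, hPP'.apply_cons_eq, diffAt_natural hψ hQ hQ' hQQ', map_add,
    mul_add, Finset.sum_add_distrib]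
  rfl

theorem schoutenRightPart_natural {p q n : ℕ} (hn : p + q = n) {ψ : E → F}
    {P : E → Multivector E p} {P' : F → Multivector F p}
    {Q : E → Multivector E (q + 1)} {Q' : F → Multivector F (q + 1)} {x : E}
    (hψ : ContDiffAt ℝ 2 ψ x)
    (hP : DifferentiableAt ℝ P x) (hP' : DifferentiableAt ℝ P' (ψ x))
    (hPP' : IsPushforwardAt ψ P P' x) (hQQ' : IsPushforwardAt ψ Q Q' x)
    (v : Fin n → (F →L[ℝ] ℝ)) :
    schoutenRightPart hn P' Q' (ψ x) v =
      schoutenRightPart hn P Q x (fun i => (v i).comp (fderiv ℝ ψ x)) +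
      (p.factorial * q.factorial : ℝ)⁻¹ *
      ∑ σ : Equiv.Perm (Fin n), ((Equiv.Perm.sign σ : ℤ) : ℝ) *
        freeFirst (Q x)
          (fun j => (v (σ (Fin.cast hn (Fin.natAdd p j)))).comp (fderiv ℝ ψ x))
          (slotSum (P x) (fun i => (v (σ (Fin.cast hn (Fin.castAdd q i)))).comp (fderiv ℝ ψ x))
            fun i => covectorHessian ψ x (v (σ (Fin.cast hn (Fin.castAdd q i))))) := by
  simp only [schoutenRightPart_apply, hQQ'.apply_cons_eq, diffAt_natural hψ hP hP' hPP', map_add,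
    mul_add, Finset.sum_add_distrib]
  rfl

theorem slotSum_of_isEmpty {V : Type*} [NormedAddCommGroup V] [NormedSpace ℝ V]
    (B : AltForm V 0) (w : Fin 0 → V) (S : Fin 0 → (E →L[ℝ] V)) : slotSum B w S = 0 := by
  simp [slotSum]

/-- The Schouten bracket is natural with respect to local diffeomorphisms. -/
theorem schoutenVS_natural [FiniteDimensional ℝ E] {p q : ℕ} {ψ : E → F} {P : E → Multivector E p}
    {P' : F → Multivector F p} {Q : E → Multivector E q} {Q' : F → Multivector F q} {x : E}
    (hψ : ContDiffAt ℝ 2 ψ x)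
    (hP : DifferentiableAt ℝ P x) (hP' : DifferentiableAt ℝ P' (ψ x))
    (hQ : DifferentiableAt ℝ Q x) (hQ' : DifferentiableAt ℝ Q' (ψ x))
    (hPP' : IsPushforwardAt ψ P P' x) (hQQ' : IsPushforwardAt ψ Q Q' x) :
    schoutenVS P' Q' (ψ x) = (schoutenVS P Q x).compContinuousLinearMap
      (ContinuousLinearMap.precomp ℝ (fderiv ℝ ψ x)) := by
  match p, q, P, P', Q, Q' with
  | 0, 0, P, P', Q, Q' => rfl
  | p + 1, 0, P, P', Q, Q' =>
    ext v
    refine (schoutenLeftPart_natural _ hψ hQ hQ' hPP' hQQ' v).trans ?_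
    -- A function has no slots, hence no Hessian term: the single half is invariant by itself.
    simp only [slotSum_of_isEmpty, map_zero, mul_zero, Finset.sum_const_zero, add_zero]
    rfl
  | 0, q + 1, P, P', Q, Q' =>
    ext v
    refine (congrArg Neg.neg (schoutenRightPart_natural (by omega) hψ hP hP' hPP' hQQ' v)).trans ?_
    simp only [slotSum_of_isEmpty, map_zero, mul_zero, Finset.sum_const_zero, add_zero]
    rfl
  | p + 1, q + 1, P, P', Q, Q' =>
    ext v
    refine (congrArg₂ (· - ·) (schoutenLeftPart_natural (by omega) hψ hQ hQ' hPP' hQQ' v)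
      (schoutenRightPart_natural (by omega) hψ hP hP' hPP' hQQ' v)).trans ?_
    have hs := sum_slotSum_left_eq_right (n := p + 1 + (q + 1) - 1) (by omega) (by omega) (P x)
      (Q x) (fun i => (v i).comp (fderiv ℝ ψ x)) (S := fun i => covectorHessian ψ x (v i))
      (fun i u w => by
        rw [covectorHessian_apply, covectorHessian_apply, hψ.isSymmSndFDerivAt (by simp) u w])
    rw [hs]
    exact add_sub_add_right_eq_sub _ _ _

end Naturality

/-! ### Chart independence on a manifold without boundary. -/

section Charts

variable {E : Type*} [NormedAddCommGroup E] [NormedSpace ℝ E]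
  {H : Type*} [TopologicalSpace H] {I : ModelWithCorners ℝ E H}
  {M : Type*} [TopologicalSpace M] [ChartedSpace H M]

variable (I) in
/-- The change of coordinates from the preferred chart at `x₀` to the preferred chart at `x₁`. -/
noncomputable def chartTransition (x₀ x₁ : M) : E → E := extChartAt I x₁ ∘ (extChartAt I x₀).symm

theorem chartTransition_extChartAt {x₀ x₁ y : M} (h₀ : y ∈ (extChartAt I x₀).source) :
    chartTransition I x₀ x₁ (extChartAt I x₀ y) = extChartAt I x₁ y := by
  rw [chartTransition, Function.comp_apply, (extChartAt I x₀).left_inv h₀]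

namespace MultivectorField

theorem inChart_extChartAt {r : ℕ} (X : MultivectorField I M r) {x₀ y : M}
    (h₀ : y ∈ (extChartAt I x₀).source) :
    X.inChart x₀ (extChartAt I x₀ y) = (X y).compContinuousLinearMap
      (ContinuousLinearMap.precomp ℝ (mfderiv I 𝓘(ℝ, E) (extChartAt I x₀) y)) := by
  unfold inChart
  rw [(extChartAt I x₀).left_inv h₀]
  rfl

theorem isSmooth_of_contDiffAt {r : ℕ} {X : MultivectorField I M r}
    {A : M → E → Multivector E r}
    (hA : ∀ x₀ y, y ∈ (extChartAt I x₀).source → ContDiffAt ℝ ∞ (A x₀) (extChartAt I x₀ y))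
    (hX : ∀ x₀ y, y ∈ (extChartAt I x₀).source →
      X.inChart x₀ (extChartAt I x₀ y) = A x₀ (extChartAt I x₀ y)) : X.IsSmooth := by
  intro x₀
  refine ContDiffOn.congr (f := A x₀) (fun z hz => ?_) fun z hz => ?_
  · have h := hA x₀ _ ((extChartAt I x₀).map_target hz)
    rw [(extChartAt I x₀).right_inv hz] at h
    exact h.contDiffWithinAt
  · have h := hX x₀ _ ((extChartAt I x₀).map_target hz)
    rwa [(extChartAt I x₀).right_inv hz] at h

end MultivectorField

variable [I.Boundaryless]

theorem eventually_mem_target_and_symm_mem {x₀ x₁ y : M} (h₀ : y ∈ (extChartAt I x₀).source)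
    (h₁ : y ∈ (extChartAt I x₁).source) :
    ∀ᶠ z in 𝓝 (extChartAt I x₀ y),
      z ∈ (extChartAt I x₀).target ∧ (extChartAt I x₀).symm z ∈ (extChartAt I x₁).source := by
  have ht : extChartAt I x₀ y ∈ (extChartAt I x₀).target := (extChartAt I x₀).map_source h₀
  refine Filter.Eventually.and (extChartAt_target_mem_nhds' ht) ?_
  refine (continuousAt_extChartAt_symm'' ht).eventually_mem ?_
  rw [(extChartAt I x₀).left_inv h₀]
  exact extChartAt_source_mem_nhds' h₁

theorem contDiffAt_chartTransition {n : ℕ∞ω} [IsManifold I n M] {x₀ x₁ y : M}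
    (h₀ : y ∈ (extChartAt I x₀).source) (h₁ : y ∈ (extChartAt I x₁).source) :
    ContDiffAt ℝ n (chartTransition I x₀ x₁) (extChartAt I x₀ y) := by
  have h : extChartAt I x₀ y ∈ ((extChartAt I x₀).symm.trans (extChartAt I x₁)).source := by
    rw [PartialEquiv.trans_source]
    refine ⟨(extChartAt I x₀).map_source h₀, ?_⟩
    rw [Set.mem_preimage, (extChartAt I x₀).left_inv h₀]
    exact h₁
  have h' := contDiffWithinAt_ext_coord_change (I := I) (n := n) x₁ x₀ h
  rwa [I.range_eq_univ, contDiffWithinAt_univ] at h'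

theorem fderiv_chartTransition_comp_mfderiv [IsManifold I 1 M] {x₀ x₁ y : M}
    (h₀ : y ∈ (extChartAt I x₀).source) (h₁ : y ∈ (extChartAt I x₁).source) :
    (fderiv ℝ (chartTransition I x₀ x₁) (extChartAt I x₀ y) : E →L[ℝ] E).comp
      (mfderiv I 𝓘(ℝ, E) (extChartAt I x₀) y : TangentSpace I y →L[ℝ] E) =
      mfderiv I 𝓘(ℝ, E) (extChartAt I x₁) y := by
  have hd : MDifferentiableAt 𝓘(ℝ, E) 𝓘(ℝ, E) (chartTransition I x₀ x₁) (extChartAt I x₀ y) :=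
    ((contDiffAt_chartTransition (n := 1) h₀ h₁).differentiableAt one_ne_zero).mdifferentiableAt
  have hd' : MDifferentiableAt I 𝓘(ℝ, E) (extChartAt I x₀) y :=
    mdifferentiableAt_extChartAt (by rwa [extChartAt_source] at h₀)
  have hcomp := mfderiv_comp y hd hd'
  rw [mfderiv_eq_fderiv] at hcomp
  refine hcomp.symm.trans (Filter.EventuallyEq.mfderiv_eq ?_)
  filter_upwards [extChartAt_source_mem_nhds' h₀] with w hw
  exact chartTransition_extChartAt hw

namespace MultivectorField

theorem inChart_chartTransition [IsManifold I 1 M] {r : ℕ} (X : MultivectorField I M r)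
    {x₀ x₁ y : M} (h₀ : y ∈ (extChartAt I x₀).source) (h₁ : y ∈ (extChartAt I x₁).source) :
    X.inChart x₁ (chartTransition I x₀ x₁ (extChartAt I x₀ y)) =
      (X.inChart x₀ (extChartAt I x₀ y)).compContinuousLinearMap (ContinuousLinearMap.precomp ℝ
        (fderiv ℝ (chartTransition I x₀ x₁) (extChartAt I x₀ y))) := by
  rw [chartTransition_extChartAt h₀, inChart_extChartAt X h₀, inChart_extChartAt X h₁,
    ← fderiv_chartTransition_comp_mfderiv h₀ h₁]
  rfl

theorem isPushforwardAt_inChart [IsManifold I 1 M] {r : ℕ} (X : MultivectorField I M r)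
    {x₀ x₁ y : M} (h₀ : y ∈ (extChartAt I x₀).source) (h₁ : y ∈ (extChartAt I x₁).source) :
    IsPushforwardAt (chartTransition I x₀ x₁) (X.inChart x₀) (X.inChart x₁)
      (extChartAt I x₀ y) := by
  filter_upwards [eventually_mem_target_and_symm_mem h₀ h₁] with z hz
  have h := X.inChart_chartTransition ((extChartAt I x₀).map_target hz.1) hz.2
  rwa [(extChartAt I x₀).right_inv hz.1] at h

/-- The expression in an arbitrary chart of a field which is defined pointwise by its expression in
the preferred chart at each point. -/
theorem inChart_ofChart [IsManifold I 1 M] {r : ℕ} (A : M → Multivector E r)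
    {x₀ y : M} (h₀ : y ∈ (extChartAt I x₀).source) :
    inChart (I := I) (fun x => ofChart I x (A x)) x₀ (extChartAt I x₀ y) =
      (A y).compContinuousLinearMap (ContinuousLinearMap.precomp ℝ
        (fderiv ℝ (chartTransition I y x₀) (extChartAt I y y))) := by
  have hy : y ∈ (extChartAt I y).source := mem_extChartAt_source y
  have hinv : (mfderiv I 𝓘(ℝ, E) (extChartAt I y) y).comp
      (mfderiv I 𝓘(ℝ, E) (extChartAt I y) y).inverse = ContinuousLinearMap.id ℝ _ :=
    (isInvertible_mfderiv_extChartAt hy).self_comp_inverse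
  rw [inChart_extChartAt _ h₀, ← fderiv_chartTransition_comp_mfderiv hy h₀]
  ext v
  change A y _ = A y _
  congr 1
  ext i u
  have := DFunLike.congr_fun hinv u
  exact congrArg (fun w : E => v i (fderiv ℝ (chartTransition I y x₀) (extChartAt I y y) w)) this

theorem IsSmooth.contDiffAt {r : ℕ} {X : MultivectorField I M r} (hX : X.IsSmooth) {x₀ y : M}
    (h₀ : y ∈ (extChartAt I x₀).source) :
    ContDiffAt ℝ ∞ (X.inChart x₀) (extChartAt I x₀ y) :=
  (hX x₀).contDiffAt (extChartAt_target_mem_nhds' ((extChartAt I x₀).map_source h₀))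

section Schouten

variable [FiniteDimensional ℝ E] [IsManifold I 2 M] {p q : ℕ} {X : MultivectorField I M p}
  {Y : MultivectorField I M q}

/-- The definition changes chart from point to point; naturality under transition maps lets one
chart compute the bracket on its whole domain. -/
theorem inChart_schouten (hX : X.IsSmooth) (hY : Y.IsSmooth) {x₀ y : M}
    (h₀ : y ∈ (extChartAt I x₀).source) :
    (X.schouten Y).inChart x₀ (extChartAt I x₀ y) =
      schoutenVS (X.inChart x₀) (Y.inChart x₀) (extChartAt I x₀ y) := by
  have hy : y ∈ (extChartAt I y).source := mem_extChartAt_source y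
  have hψ := chartTransition_extChartAt (x₁ := x₀) hy
  refine (inChart_ofChart (fun x => schoutenVS (X.inChart x) (Y.inChart x) (extChartAt I x x))
    h₀).trans ?_
  have h := schoutenVS_natural (P := X.inChart y) (P' := X.inChart x₀) (Q := Y.inChart y)
    (Q' := Y.inChart x₀) (contDiffAt_chartTransition (n := 2) hy h₀)
    ((hX.contDiffAt hy).differentiableAt (by simp))
    (by rw [hψ]; exact (hX.contDiffAt h₀).differentiableAt (by simp))
    ((hY.contDiffAt hy).differentiableAt (by simp))
    (by rw [hψ]; exact (hY.contDiffAt h₀).differentiableAt (by simp))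
    (X.isPushforwardAt_inChart hy h₀) (Y.isPushforwardAt_inChart hy h₀)
  rw [← h, hψ]

theorem IsSmooth.schouten (hX : X.IsSmooth) (hY : Y.IsSmooth) : (X.schouten Y).IsSmooth :=
  isSmooth_of_contDiffAt
    -- The lost derivative is harmless, as `∞ + 1 = ∞`.
    (fun _ _ h₀ => contDiffAt_schoutenVS (n := ∞) (hX.contDiffAt h₀) (hY.contDiffAt h₀))
    fun _ _ h₀ => inChart_schouten hX hY h₀

end Schouten

end MultivectorField

end Charts

/-! ### Transition maps of the tangent bundle. -/

section TangentBundleCharts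

variable {E : Type*} [NormedAddCommGroup E] [NormedSpace ℝ E]
  {H : Type*} [TopologicalSpace H] {I : ModelWithCorners ℝ E H}
  {M : Type*} [TopologicalSpace M] [ChartedSpace H M] [IsManifold I 1 M]

theorem extChartAt_tangentBundle_apply (v w : TangentBundle I M) :
    extChartAt I.tangent v w = (extChartAt I v.proj w.proj,
      tangentCoordChange I w.proj v.proj w.proj w.2) := by
  rw [ModelWithCorners.tangent, FiberBundle.extChartAt]
  rfl

theorem mem_extChartAt_tangentBundle_source {v w : TangentBundle I M} :
    w ∈ (extChartAt I.tangent v).source ↔ w.proj ∈ (extChartAt I v.proj).source := by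
  rw [extChartAt_source, extChartAt_source]
  exact TangentBundle.mem_chart_source_iff w v

variable [I.Boundaryless]

theorem chartTransition_tangentBundle {v₀ v₁ w : TangentBundle I M}
    (h₀ : w ∈ (extChartAt I.tangent v₀).source) (h₁ : w ∈ (extChartAt I.tangent v₁).source) :
    chartTransition I.tangent v₀ v₁ =ᶠ[𝓝 (extChartAt I.tangent v₀ w)]
      tangentMapVS (chartTransition I v₀.proj v₁.proj) := by
  filter_upwards [eventually_mem_target_and_symm_mem h₀ h₁] with ζ hζ
  obtain ⟨ht, hs⟩ := hζ
  have ht' := (extChartAt I.tangent v₀).map_target ht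
  have hζ := (extChartAt I.tangent v₀).right_inv ht
  rw [chartTransition, Function.comp_apply]
  set w' := (extChartAt I.tangent v₀).symm ζ with hw'
  rw [mem_extChartAt_tangentBundle_source] at ht' hs
  rw [← hζ, extChartAt_tangentBundle_apply, extChartAt_tangentBundle_apply, tangentMapVS,
    chartTransition_extChartAt ht']
  congr 1
  -- Cocycle identity: the change to the chart at `v₁` factors through the one at `v₀`, and the
  -- second factor is the derivative of the transition map of `M`.
  have h := tangentCoordChange_comp (I := I) (w := w'.proj) (x := v₀.proj) (y := v₁.proj)
    (z := w'.proj) (v := w'.2) ⟨⟨mem_extChartAt_source _, ht'⟩, hs⟩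
  rw [← h, tangentCoordChange_def (x := v₀.proj), I.range_eq_univ, fderivWithin_univ]
  rfl

end TangentBundleCharts

/-! ### The tangent lift on manifolds and the theorem. -/

namespace MultivectorField

variable {E : Type*} [NormedAddCommGroup E] [NormedSpace ℝ E]
  {H : Type*} [TopologicalSpace H] {I : ModelWithCorners ℝ E H}
  {M : Type*} [TopologicalSpace M] [ChartedSpace H M] [IsManifold I ∞ M]

theorem tangentLift_zero (r : ℕ) : (0 : MultivectorField I M r).tangentLift = 0 := by
  ext1 v
  refine (congrArg (ofChart I.tangent v) (tangentLiftVS_zero _)).trans ?_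
  rfl

variable [I.Boundaryless]

theorem inChart_tangentLift {r : ℕ} {X : MultivectorField I M r} (hX : X.IsSmooth)
    {v₀ w : TangentBundle I M} (h₀ : w ∈ (extChartAt I.tangent v₀).source) :
    X.tangentLift.inChart v₀ (extChartAt I.tangent v₀ w) =
      tangentLiftVS (X.inChart v₀.proj) (extChartAt I.tangent v₀ w) := by
  have hw : w ∈ (extChartAt I.tangent w).source := mem_extChartAt_source w
  have hwM : w.proj ∈ (extChartAt I w.proj).source := mem_extChartAt_source _
  have h₀M := mem_extChartAt_tangentBundle_source.1 h₀
  have hT := chartTransition_tangentBundle hw h₀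
  have hw1 : (extChartAt I.tangent w w).1 = extChartAt I w.proj w.proj := by
    rw [extChartAt_tangentBundle_apply]
  have hψ := chartTransition_extChartAt (x₁ := v₀.proj) hwM
  refine (inChart_ofChart (fun v : TangentBundle I M =>
    tangentLiftVS (X.inChart v.proj) (extChartAt I.tangent v v)) h₀).trans ?_
  have h := tangentLiftVS_natural (ψ := chartTransition I w.proj v₀.proj) (P := X.inChart w.proj)
    (P' := X.inChart v₀.proj) (z := extChartAt I.tangent w w)
    (by rw [hw1]; exact contDiffAt_chartTransition (n := 2) hwM h₀M)
    (by rw [hw1]; exact (hX.contDiffAt hwM).differentiableAt (by simp))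
    (by rw [hw1, hψ]; exact (hX.contDiffAt h₀M).differentiableAt (by simp))
    (by rw [hw1]; exact X.isPushforwardAt_inChart hwM h₀M)
  rw [hT.fderiv_eq, ← h, ← hT.eq_of_nhds, chartTransition_extChartAt hw]

variable [FiniteDimensional ℝ E]

theorem IsSmooth.tangentLift {r : ℕ} {X : MultivectorField I M r} (hX : X.IsSmooth) :
    X.tangentLift.IsSmooth :=
  isSmooth_of_contDiffAt
    (A := fun v₀ => tangentLiftVS (X.inChart v₀.proj))
    (fun v₀ w h₀ => contDiffAt_tangentLiftVS (n := ∞) (by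
      rw [extChartAt_tangentBundle_apply]
      exact hX.contDiffAt (mem_extChartAt_tangentBundle_source.1 h₀)))
    fun _ _ h₀ => inChart_tangentLift hX h₀

theorem schouten_tangentLift {p q : ℕ} {X : MultivectorField I M p} {Y : MultivectorField I M q}
    (hX : X.IsSmooth) (hY : Y.IsSmooth) :
    X.tangentLift.schouten Y.tangentLift = (X.schouten Y).tangentLift := by
  -- The bracket differentiates, so the chart formula for the lifts is needed near the point and not
  -- only at it.
  have hlift : ∀ {r : ℕ} {Z : MultivectorField I M r}, Z.IsSmooth → ∀ v : TangentBundle I M,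
      Z.tangentLift.inChart v =ᶠ[𝓝 (extChartAt I.tangent v v)]
        tangentLiftVS (Z.inChart v.proj) := by
    intro r Z hZ v
    filter_upwards [extChartAt_target_mem_nhds (I := I.tangent) v] with ζ hζ
    have h := inChart_tangentLift hZ ((extChartAt I.tangent v).map_target hζ)
    rwa [(extChartAt I.tangent v).right_inv hζ] at h
  ext1 v
  have hv : (extChartAt I.tangent v v).1 = extChartAt I v.proj v.proj := by
    rw [extChartAt_tangentBundle_apply]
  have hs : (X.schouten Y).inChart v.proj =ᶠ[𝓝 (extChartAt I.tangent v v).1]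
      schoutenVS (X.inChart v.proj) (Y.inChart v.proj) := by
    rw [hv]
    filter_upwards [extChartAt_target_mem_nhds (I := I) v.proj] with z hz
    have h := inChart_schouten hX hY ((extChartAt I v.proj).map_target hz)
    rwa [(extChartAt I v.proj).right_inv hz] at h
  have hX' : ContDiffAt ℝ 2 (X.inChart v.proj) (extChartAt I.tangent v v).1 := by
    rw [hv]; exact (hX.contDiffAt (mem_extChartAt_source _)).of_le ENat.LEInfty.out
  have hY' : ContDiffAt ℝ 2 (Y.inChart v.proj) (extChartAt I.tangent v v).1 := by
    rw [hv]; exact (hY.contDiffAt (mem_extChartAt_source _)).of_le ENat.LEInfty.out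
  refine congrArg (ofChart I.tangent v) ?_
  rw [schoutenVS_congr (hlift hX v) (hlift hY v), schoutenVS_tangentLiftVS hX' hY',
    tangentLiftVS_congr hs]

theorem IsPoisson.tangentLift {L : MultivectorField I M 2} (hL : L.IsPoisson) :
    L.tangentLift.IsPoisson :=
  ⟨hL.1.tangentLift, by
    rw [schouten_tangentLift hL.1 hL.1, hL.2]
    exact tangentLift_zero _⟩

end MultivectorField

theorem theorem2p5 {E : Type*} [NormedAddCommGroup E] [NormedSpace ℝ E] [FiniteDimensional ℝ E]
    {H : Type*} [TopologicalSpace H] (I : ModelWithCorners ℝ E H) [I.Boundaryless]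
    (M : Type*) [TopologicalSpace M] [ChartedSpace H M] [IsManifold I ∞ M] :
    -- the tangent lift maps multivector fields on `M` to multivector fields on `TM`
    (∀ (r : ℕ) (X : MultivectorField I M r), X.IsSmooth → X.tangentLift.IsSmooth) ∧
    -- the tangent lift commutes with the Schouten bracket
    (∀ (p q : ℕ) (X : MultivectorField I M p) (Y : MultivectorField I M q),
      X.IsSmooth → Y.IsSmooth →
        (X.schouten Y).IsSmooth ∧
        X.tangentLift.schouten Y.tangentLift = (X.schouten Y).tangentLift) ∧
    -- the tangent lift of a Poisson bivector is a Poisson bivector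
    (∀ L : MultivectorField I M 2, L.IsPoisson → L.tangentLift.IsPoisson) :=
  ⟨fun _ _ hX => hX.tangentLift,
    fun _ _ _ _ hX hY => ⟨hX.schouten hY, MultivectorField.schouten_tangentLift hX hY⟩,
    fun _ hL => hL.tangentLift⟩
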